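/- **Conventions.** Ordinals are identified with the set of smaller ordinals; "order-preserving" means strictly increasing; $f[a]$ is the image of $a$ under $f$. A *partial order* is a set with a reflexive transitive relation (antisymmetry is not required). Elements $p,q$ are *compatible* in $\mathbb P$ if some $r\in\mathbb P$ has $r\le p,q$; $\mathbb P$ satisfies the $\mu$-cc if every set of pairwise incompatible elements has size $<\mu$. A map $\sigma:\mathbb P\to\mathbb Q$ is an *embedding* if $p'\le p$ implies $\sigma(p')\le\sigma(p)$, and $p,p'$ are incompatible iff $\sigma(p),\sigma(p')$ are. An element $p\in\mathbb P$ is a *reduction* of $q\in\mathbb Q$ with respect to $\sigma$ if $\sigma(p')$ is compatible with $q$ for all $p'\le p$ in $\mathbb P$; $\sigma$ is a *complete embedding* if it is an embedding and every $q\in\mathbb Q$ has a reduction. $\mathbb P\subseteq_\perp\mathbb Q$ means that $\mathbb P\subseteq\mathbb Q$ and the identity is an embedding. **Gap-1 morasses.** For a cardinal $\lambda$, a *simplified $(\lambda,1)$-morass* is $\langle\langle\varphi_\zeta\mid\zeta\le\lambda\rangle,\langle\mathfrak G_{\zeta\xi}\mid\zeta<\xi\le\lambda\rangle\rangle$ with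 $\varphi_0=1$, $\varphi_\lambda=\lambda^+$, $0<\varphi_\zeta<\lambda$ for $\zeta<\lambda$; $\mathfrak G_{\zeta\xi}$ is a set of order-preserving $f:\varphi_\zeta\to\varphi_\xi$; $|\mathfrak G_{\zeta\xi}|<\lambda$ for $\zeta<\xi<\lambda$; $\mathfrak G_{\zeta\eta}=\{f\circ g\mid f\in\mathfrak G_{\xi\eta},g\in\mathfrak G_{\zeta\xi}\}$ for $\zeta<\xi<\eta$; $\mathfrak G_{\zeta,\zeta+1}=\{\mathrm{id}\restriction\varphi_\zeta,h_\zeta\}$, where for some $\delta<\varphi_\zeta$, $h_\zeta\restriction\delta=\mathrm{id}$ and $h_\zeta(\delta)\ge\varphi_\zeta$; if $\alpha\le\lambda$ is a limit, $\beta_1,\beta_2<\alpha$ and $f_i\in\mathfrak G_{\beta_i\alpha}$, then there are $\gamma$ with $\beta_1,\beta_2<\gamma<\alpha$, $g\in\mathfrak G_{\gamma\alpha}$ and $j_i\in\mathfrak G_{\beta_i\gamma}$ with $f_i=g\circ j_i$ ($i=1,2$); and $\varphi_\alpha=\bigcup\{f[\varphi_\beta]\mid\beta<\alpha,f\in\mathfrak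 G_{\beta\alpha}\}$ for $\alpha>0$. The *split point* $\delta_\zeta$ is the least ordinal moved by $h_\zeta$. Let $T=\{\langle\alpha,\nu\rangle\mid\alpha\le\lambda,\nu<\varphi_\alpha\}$. For $s=\langle\alpha,\nu\rangle$ write $\alpha(s)=\alpha$, $\nu(s)=\nu$. Put $s\prec t$ iff $\alpha(s)<\alpha(t)$ and $f(\nu(s))=\nu(t)$ for some $f\in\mathfrak G_{\alpha(s)\alpha(t)}$; then $\pi_{st}=f\restriction(\nu(s)+1)$, which does not depend on $f$. **Gap-2 morasses.** Let $\langle\varphi,\mathfrak G\rangle$ be a simplified $(\kappa^+,1)$-morass. For $\theta,\theta'\le\kappa^+$ an *embedding* from level $\theta$ to level $\theta'$ consists of an order-preserving $f:\theta+1\to\theta'+1$ with $f(\theta)=\theta'$, order-preserving $f_\zeta:\varphi_\zeta\to\varphi_{f(\zeta)}$ ($\zeta\le\theta$), and maps $f_{\zeta\xi}:\mathfrak G_{\zeta\xi}\to\mathfrak G_{f(\zeta)f(\xi)}$ ($\zeta<\xi\le\theta$) such that $f_\zeta(\delta_\zeta)=\delta_{f(\zeta)}$ for $\zeta<\theta$,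 $f_{\zeta\eta}(c\circ b)=f_{\xi\eta}(c)\circ f_{\zeta\xi}(b)$ and $f_\xi\circ b=f_{\zeta\xi}(b)\circ f_\zeta$ (for $b\in\mathfrak G_{\zeta\xi}$, $c\in\mathfrak G_{\xi\eta}$). Embeddings are composed by $(f\circ g)(\zeta)=f(g(\zeta))$, $(f\circ g)_\zeta=f_{g(\zeta)}\circ g_\zeta$, $(f\circ g)_{\zeta\xi}=f_{g(\zeta)g(\xi)}\circ g_{\zeta\xi}$. For $\theta<\theta'$, $f$ is *left-branching* if $f\restriction\theta$, $f_\zeta$ ($\zeta<\theta$), $f_{\zeta\xi}$ ($\zeta<\xi<\theta$) are identities, $f_\theta\in\mathfrak G_{\theta\theta'}$, and $f_{\zeta\theta}(b)=f_\theta\circ b$. It is *right-branching* if for some $\eta<\theta$: $f\restriction\eta$, $f_\zeta$ ($\zeta<\eta$), $f_{\zeta\xi}$ ($\zeta<\xi<\eta$) are identities, $f(\eta+\zeta)=\theta+\zeta$ whenever $\eta+\zeta\le\theta$, $f_\eta\in\mathfrak G_{\eta\theta}$, and $f_{\zeta\xi}[\mathfrak G_{\zeta\xi}]=\mathfrak G_{f(\zeta)f(\xi)}$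 for $\eta\le\zeta<\xi\le\theta$. An *amalgamation* consists of all left-branching embeddings and exactly one right-branching embedding. For regular $\kappa\geq\omega$, a *simplified $(\kappa,2)$-morass* consists of a simplified $(\kappa^+,1)$-morass $\langle\varphi,\mathfrak G\rangle$ with $\varphi_\zeta<\kappa$ for $\zeta<\kappa$, ordinals $0<\theta_\alpha<\kappa$ ($\alpha<\kappa$), $\theta_\kappa=\kappa^+$, and sets $\mathfrak F_{\alpha\beta}$ ($\alpha<\beta\le\kappa$) of embeddings from level $\theta_\alpha$ to level $\theta_\beta$ such that: $|\mathfrak F_{\alpha\beta}|<\kappa$ for $\alpha<\beta<\kappa$; $\mathfrak F_{\alpha\gamma}=\{f\circ g\mid f\in\mathfrak F_{\beta\gamma},g\in\mathfrak F_{\alpha\beta}\}$ for $\alpha<\beta<\gamma$; $\mathfrak F_{\alpha,\alpha+1}$ is an amalgamation (in particular $\theta_\alpha<\theta_{\alpha+1}$); the directedness condition above holds for $\mathfrak F$ at limits $\alpha\le\kappa$; and for limits $\alpha\le\kappa$, with $f$ ranging over $\bigcup_{\beta<\alpha}\mathfrak F_{\beta\alpha}$: $\theta_\alpha=\bigcup_f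 f[\theta_\beta]$; $\varphi_\zeta=\bigcup\{f_{\bar\zeta}[\varphi_{\bar\zeta}]\mid f(\bar\zeta)=\zeta\}$ for $\zeta\le\theta_\alpha$; and $\mathfrak G_{\zeta\xi}=\bigcup\{f_{\bar\zeta\bar\xi}[\mathfrak G_{\bar\zeta\bar\xi}]\mid f(\bar\zeta)=\zeta,f(\bar\xi)=\xi\}$ for $\zeta<\xi\le\theta_\alpha$. Put $\mathfrak F'_{\alpha\beta}=\{f\restriction\theta_\alpha\mid f\in\mathfrak F_{\alpha\beta}\}$, and define $T',\prec',\pi'_{st}$ (on ordinals) from $\langle\langle\theta_\alpha\mid\alpha\le\kappa\rangle,\langle\mathfrak F'_{\alpha\beta}\mid\alpha<\beta\leq\kappa\rangle\rangle$ as $T,\prec,\pi_{st}$ were defined above. Here $h_\alpha\in\mathfrak F'_{\alpha,\alpha+1}$ is the restriction of the right-branching embedding. **FS systems, gap 1.** An *FS system along a simplified $(\lambda,1)$-morass* is $\langle\langle\mathbb P_\eta\mid\eta\le\lambda^+\rangle,\langle\sigma_{st}\mid s\prec t\rangle,\langle e_\alpha\mid\alpha<\lambda\rangle\rangle$ such that: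 (1) the $\mathbb P_\eta$ are partial orders, $\mathbb P_\eta\subseteq_\perp\mathbb P_\nu$ for $\eta\le\nu$, and $\mathbb P_\rho=\bigcup_{\eta<\rho}\mathbb P_\eta$ (as sets) for limit $\rho$; (2) the $\sigma_{st}:\mathbb P_{\nu(s)+1}\to\mathbb P_{\nu(t)+1}$ are commuting injective embeddings, and $\mathbb P_{\nu(t)+1}=\bigcup_{s\prec t}\sigma_{st}[\mathbb P_{\nu(s)+1}]$ if $\alpha(t)$ is a limit; (3) $e_\alpha:\mathbb P_{\varphi_{\alpha+1}}\to\mathbb P_{\varphi_\alpha}$; (4) if $s\prec t$ and $\pi_{st}(\nu')=\tau'$, then $\sigma_{st}$ extends $\sigma_{s't'}$ for $s'=\langle\alpha(s),\nu'\rangle$, $t'=\langle\alpha(t),\tau'\rangle$; put $\sigma_\alpha=\bigcup\{\sigma_{st}\mid s=\langle\alpha,\nu\rangle,t=\langle\alpha+1,h_\alpha(\nu)\rangle,\nu<\varphi_\alpha\}$; (5) if $\pi_{st}=\mathrm{id}$, then $\sigma_{st}=\mathrm{id}$; (6) for $\alpha<\lambda$, $\mathbb P_{\varphi_\alpha}\subseteq\mathbb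 P_{\varphi_{\alpha+1}}$, both $\mathrm{id}$ and $\sigma_\alpha$ are complete embeddings of $\mathbb P_{\varphi_\alpha}$ into $\mathbb P_{\varphi_{\alpha+1}}$, and $e_\alpha(p)$ is a reduction of each $p\in\mathbb P_{\varphi_{\alpha+1}}$ with respect to both; (7) $e_\alpha(p)=p$ for $p\in\mathbb P_{\varphi_\alpha}$, and $e_\alpha(p)=\sigma_\alpha^{-1}(p)$ for $p\in\mathrm{rng}(\sigma_\alpha)$. **The derived order.** Let such a system along a simplified $(\kappa^+,1)$-morass be given ($\lambda=\kappa^+$), and $\mathbb P=\mathbb P_{\kappa^{++}}$. For $p\in\mathbb P$ define recursively $p_0=p$; $\nu_n(p)=\min\{\eta\mid p_n\in\mathbb P_{\eta+1}\}$; $t_n(p)=\langle\kappa^+,\nu_n(p)\rangle$; $p^{(n)}(\alpha)=\sigma_{st}^{-1}(p_n)$ if $s\prec t=t_n(p)$, $\alpha(s)=\alpha$ and $p_n\in\mathrm{rng}(\sigma_{st})$; $\gamma_n(p)=\min(\mathrm{dom}(p^{(n)}))$, which is $0$ or a successor; and, if $\gamma_n(p)\ne0$, $p_{n+1}=e_{\gamma_n(p)-1}(p^{(n)}(\gamma_n(p)))$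 (otherwise $p_{n+1}$ is undefined). With $\gamma_{-1}(p)=\kappa^+$, let $p^*=\bigcup_n p^{(n)}\restriction[\gamma_n(p),\gamma_{n-1}(p)[$ and $\mathrm{supp}(p)=\{\gamma_n(p)\mid n\in\omega\}$, the unions and sets being over those $n$ for which $p_n$ is defined. The derived order is $\mathbb Q=\{p^*\restriction\mathrm{supp}(p)\mid p\in\mathbb P\}$, with $p\le q$ iff $\mathrm{dom}(q)\subseteq\mathrm{dom}(p)$ and $p(\alpha)\le q(\alpha)$ in $\mathbb P_{\varphi_\alpha}$ for all $\alpha\in\mathrm{dom}(q)$. For an ordinal $\gamma$ let $\mathbb Q_\gamma=\{p\in\mathbb Q\mid\mathrm{dom}(p)\subseteq\gamma\}$, with the order of $\mathbb Q$. **FS systems, gap 2.** $\langle\langle\mathbb P_\eta\mid\eta\le\kappa^{++}\rangle,\langle\sigma_{st}\mid s\prec t\rangle,\langle\sigma'_{st}\mid s\prec't\rangle,\langle e_\alpha\mid\alpha<\kappa^+\rangle,\langle e'_\alpha\mid\alpha<\kappa\rangle\rangle$ is an *FS system along a simplified $(\kappa,2)$-morass* if $\langle\mathbb P_\eta\rangle,\langle\sigma_{st}\rangle,\langle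 e_\alpha\rangle$ is an FS system along $\langle\varphi,\mathfrak G\rangle$, and (2)–(7) hold with $\mathbb Q_\eta,\sigma'_{st},e'_\alpha,\prec',\pi'_{st},\theta_\alpha,\kappa$ in place of $\mathbb P_\eta,\sigma_{st},e_\alpha,\prec,\pi_{st},\varphi_\alpha,\lambda$ (and $h_\alpha\in\mathfrak F'_{\alpha,\alpha+1}$). **Theorem 3.3.** Let $\kappa,\mu>\omega$ be cardinals, $\kappa$ regular. Let $\langle\langle\mathbb P_\eta\rangle,\langle\sigma_{st}\rangle,\langle\sigma'_{st}\rangle,\langle e_\alpha\rangle,\langle e'_\alpha\rangle\rangle$ be an FS system along a simplified $(\kappa,2)$-morass, and $\mathbb P=\mathbb P_{\kappa^{++}}$. (a) If $\mathbb Q$ satisfies the $\mu$-cc, then so does $\mathbb P$. (b) Suppose that $\mu$ is regular or $\mathrm{cf}(\mu)\ne\kappa$. If all $\mathbb Q_\eta$ with $\eta<\kappa$ satisfy the $\mu$-cc, then so does $\mathbb P$. -/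

import Mathlib

open Set Cardinal Ordinal

universe u v w

noncomputable section

namespace Morass

/-! ### Functions on ordinals

A function `f : a → b` between ordinals `a = {ξ | ξ < a}` and `b` is coded by the total function
`Ordinal → Ordinal` that agrees with it on `a` and takes the value `0` off `a`.  Two functions with
domain `a` are thus equal exactly if their codes are. -/

/-- The (code of the) restriction of `f` to the ordinal `a`. -/
def restr (a : Ordinal.{u}) (f : Ordinal.{u} → Ordinal.{u}) : Ordinal.{u} → Ordinal.{u} :=
  fun ξ => if ξ < a then f ξ else 0

/-- The identity on the ordinal `a`. -/
def idOn (a : Ordinal.{u}) : Ordinal.{u} → Ordinal.{u} := restr a id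

/-- The composition `f ∘ g` of functions, where `g` has domain `a`. -/
def compOn (a : Ordinal.{u}) (f g : Ordinal.{u} → Ordinal.{u}) : Ordinal.{u} → Ordinal.{u} :=
  restr a (f ∘ g)

/-- `f` is (the code of) an order-preserving function from `a` to `b`. -/
structure IsOrderMap (a b : Ordinal.{u}) (f : Ordinal.{u} → Ordinal.{u}) : Prop where
  strictMono : StrictMonoOn f (Iio a)
  mapsTo : MapsTo f (Iio a) (Iio b)
  off : ∀ ξ, a ≤ ξ → f ξ = 0

/-! ### Simplified gap-1 morasses -/

/-- The data of a gap-1 morass: the ordinals `ht α` (written `θ_α` or `φ_α`) and the sets of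
functions `maps α β` (written `F_αβ` or `G_αβ`). -/
structure Gap1Data where
  ht : Ordinal.{u} → Ordinal.{u}
  maps : Ordinal.{u} → Ordinal.{u} → Set (Ordinal.{u} → Ordinal.{u})

/-- `⟨⟨ht α | α ≤ κ⟩, ⟨maps α β | α < β ≤ κ⟩⟩` is a (neat) simplified `(κ,1)`-morass. -/
structure Gap1Data.IsSimplifiedMorass (M : Gap1Data.{u}) (κ : Cardinal.{u}) : Prop where
  ht_zero : M.ht 0 = 1
  ht_top : M.ht κ.ord = (Order.succ κ).ord
  ht_pos : ∀ α < κ.ord, 0 < M.ht α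
  ht_lt : ∀ α < κ.ord, M.ht α < κ.ord
  isOrderMap : ∀ α β, α < β → β ≤ κ.ord → ∀ f ∈ M.maps α β, IsOrderMap (M.ht α) (M.ht β) f
  card_lt : ∀ α β, α < β → β < κ.ord → #(M.maps α β) < Cardinal.lift.{u + 1} κ
  comp : ∀ α β γ, α < β → β < γ → γ ≤ κ.ord →
    M.maps α γ = {k | ∃ f ∈ M.maps β γ, ∃ g ∈ M.maps α β, k = compOn (M.ht α) f g}
  succ : ∀ α < κ.ord, ∃ h δ, δ < M.ht α ∧ (∀ ξ < δ, h ξ = ξ) ∧ M.ht α ≤ h δ ∧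
    M.maps α (α + 1) = {idOn (M.ht α), h}
  limit : ∀ α ≤ κ.ord, Order.IsSuccLimit α → ∀ β₁ < α, ∀ β₂ < α,
    ∀ f₁ ∈ M.maps β₁ α, ∀ f₂ ∈ M.maps β₂ α,
    ∃ γ, β₁ < γ ∧ β₂ < γ ∧ γ < α ∧ ∃ g ∈ M.maps γ α, ∃ j₁ ∈ M.maps β₁ γ, ∃ j₂ ∈ M.maps β₂ γ,
      f₁ = compOn (M.ht β₁) g j₁ ∧ f₂ = compOn (M.ht β₂) g j₂
  union : ∀ α ≤ κ.ord, 0 < α →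
    Iio (M.ht α) = {τ | ∃ β < α, ∃ f ∈ M.maps β α, ∃ ξ < M.ht β, f ξ = τ}

/-- The split point `δ_ζ` of `maps ζ (ζ+1) = {id, b}`: the critical point of `b`, i.e. the least
ordinal moved by `b`. -/
def Gap1Data.splitPoint (M : Gap1Data.{u}) (ζ : Ordinal.{u}) : Ordinal.{u} :=
  sInf {δ | δ < M.ht ζ ∧ ∃ b ∈ M.maps ζ (ζ + 1), b δ ≠ δ}

/-- The tree order `s ≺ t` on `T = {⟨α, ν⟩ | α ≤ len, ν < ht α}`. -/
def Gap1Data.Prec (M : Gap1Data.{u}) (len : Ordinal.{u})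
    (s t : Ordinal.{u} × Ordinal.{u}) : Prop :=
  s.1 < t.1 ∧ t.1 ≤ len ∧ s.2 < M.ht s.1 ∧ t.2 < M.ht t.1 ∧ ∃ f ∈ M.maps s.1 t.1, f s.2 = t.2

/-! ### Embeddings between initial segments of a gap-1 morass

For `θ ≤ κ⁺` let `M↾θ = ⟨⟨φ_ζ | ζ ≤ θ⟩, ⟨G_ζξ | ζ < ξ ≤ θ⟩⟩`; these are the fake gap-1 morasses
between which the embeddings of a gap-2 morass run. -/

/-- The data of an embedding `f`: `ord ζ` is `f(ζ)`, `pt ζ τ` is `f_ζ(τ)`, and `mor ζ ξ b` is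
`f_ζξ(b)`. Again all three vanish off their domains (see `IsEmbedding`). -/
@[ext] structure EmbData where
  ord : Ordinal.{u} → Ordinal.{u}
  pt : Ordinal.{u} → Ordinal.{u} → Ordinal.{u}
  mor : Ordinal.{u} → Ordinal.{u} → (Ordinal.{u} → Ordinal.{u}) → (Ordinal.{u} → Ordinal.{u})

/-- `f` is an embedding from `M↾θ` to `M↾θ'`. -/
structure IsEmbedding (M : Gap1Data.{u}) (θ θ' : Ordinal.{u}) (f : EmbData.{u}) : Prop where
  ord_strictMono : StrictMonoOn f.ord (Iic θ)
  ord_top : f.ord θ = θ'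
  ord_off : ∀ ζ, θ < ζ → f.ord ζ = 0
  pt_isOrderMap : ∀ ζ ≤ θ, IsOrderMap (M.ht ζ) (M.ht (f.ord ζ)) (f.pt ζ)
  pt_off : ∀ ζ, θ < ζ → ∀ τ, f.pt ζ τ = 0
  mor_mem : ∀ ζ ξ, ζ < ξ → ξ ≤ θ → ∀ b ∈ M.maps ζ ξ,
    f.mor ζ ξ b ∈ M.maps (f.ord ζ) (f.ord ξ)
  mor_off : ∀ ζ ξ b, ¬ (ζ < ξ ∧ ξ ≤ θ ∧ b ∈ M.maps ζ ξ) → f.mor ζ ξ b = fun _ => 0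
  pt_split : ∀ ζ < θ, f.pt ζ (M.splitPoint ζ) = M.splitPoint (f.ord ζ)
  mor_comp : ∀ ζ ξ η, ζ < ξ → ξ < η → η ≤ θ → ∀ b ∈ M.maps ζ ξ, ∀ c ∈ M.maps ξ η,
    f.mor ζ η (compOn (M.ht ζ) c b) =
      compOn (M.ht (f.ord ζ)) (f.mor ξ η c) (f.mor ζ ξ b)
  pt_mor : ∀ ζ ξ, ζ < ξ → ξ ≤ θ → ∀ b ∈ M.maps ζ ξ, ∀ τ < M.ht ζ,
    f.pt ξ (b τ) = f.mor ζ ξ b (f.pt ζ τ)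

open Classical in
/-- The composition `f ∘ g` of embeddings, where `g` is an embedding of `M↾θ`. -/
def embComp (M : Gap1Data.{u}) (θ : Ordinal.{u}) (f g : EmbData.{u}) : EmbData.{u} where
  ord ζ := if ζ ≤ θ then f.ord (g.ord ζ) else 0
  pt ζ τ := if ζ ≤ θ ∧ τ < M.ht ζ then f.pt (g.ord ζ) (g.pt ζ τ) else 0
  mor ζ ξ b := if ζ < ξ ∧ ξ ≤ θ ∧ b ∈ M.maps ζ ξ then
    f.mor (g.ord ζ) (g.ord ξ) (g.mor ζ ξ b) else fun _ => 0

/-- `f` is a left-branching embedding from `M↾θ` to `M↾θ'`. -/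
structure IsLeftBranching (M : Gap1Data.{u}) (θ θ' : Ordinal.{u}) (f : EmbData.{u}) : Prop where
  isEmbedding : IsEmbedding M θ θ' f
  ord_eq : ∀ ζ < θ, f.ord ζ = ζ
  pt_eq : ∀ ζ < θ, ∀ τ < M.ht ζ, f.pt ζ τ = τ
  mor_eq : ∀ ζ ξ, ζ < ξ → ξ < θ → ∀ b ∈ M.maps ζ ξ, f.mor ζ ξ b = b
  pt_top : f.pt θ ∈ M.maps θ θ'
  mor_top : ∀ ζ < θ, ∀ b ∈ M.maps ζ θ, f.mor ζ θ b = compOn (M.ht ζ) (f.pt θ) b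

/-- `f` is a right-branching embedding from `M↾θ` to `M↾θ'`. -/
def IsRightBranching (M : Gap1Data.{u}) (θ θ' : Ordinal.{u}) (f : EmbData.{u}) : Prop :=
  IsEmbedding M θ θ' f ∧ ∃ η < θ,
    (∀ ζ < η, f.ord ζ = ζ) ∧
    (∀ ζ, η + ζ ≤ θ → f.ord (η + ζ) = θ + ζ) ∧
    (∀ ζ < η, ∀ τ < M.ht ζ, f.pt ζ τ = τ) ∧
    (∀ ζ ξ, ζ < ξ → ξ < η → ∀ b ∈ M.maps ζ ξ, f.mor ζ ξ b = b) ∧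
    f.pt η ∈ M.maps η θ ∧
    (∀ ζ ξ, η ≤ ζ → ζ < ξ → ξ ≤ θ →
      f.mor ζ ξ '' M.maps ζ ξ = M.maps (f.ord ζ) (f.ord ξ))

/-- An amalgamation: a family consisting of all left-branching embeddings and exactly one
right-branching embedding. -/
def IsAmalgamation (M : Gap1Data.{u}) (θ θ' : Ordinal.{u}) (F : Set EmbData.{u}) : Prop :=
  θ < θ' ∧ ∃ h, IsRightBranching M θ θ' h ∧ F = {f | IsLeftBranching M θ θ' f ∨ f = h}

/-! ### Simplified gap-2 morasses -/

/-- The data of a gap-2 morass: the gap-1 part `⟨φ, G⟩`, the ordinals `θ_α = len α`, and the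
families `F_αβ = embs α β` of embeddings. -/
structure Gap2Data where
  gap1 : Gap1Data.{u}
  len : Ordinal.{u} → Ordinal.{u}
  embs : Ordinal.{u} → Ordinal.{u} → Set EmbData.{u}

/-- `M` is a simplified `(κ,2)`-morass. -/
structure Gap2Data.IsSimplifiedMorass (M : Gap2Data.{u}) (κ : Cardinal.{u}) : Prop where
  regular : κ.IsRegular
  gap1 : M.gap1.IsSimplifiedMorass (Order.succ κ)
  ht_lt : ∀ ζ < κ.ord, M.gap1.ht ζ < κ.ord
  len_pos : ∀ α < κ.ord, 0 < M.len α
  len_lt : ∀ α < κ.ord, M.len α < κ.ord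
  len_top : M.len κ.ord = (Order.succ κ).ord
  isEmbedding : ∀ α β, α < β → β ≤ κ.ord → ∀ f ∈ M.embs α β,
    IsEmbedding M.gap1 (M.len α) (M.len β) f
  card_lt : ∀ α β, α < β → β < κ.ord → #(M.embs α β) < Cardinal.lift.{u + 1} κ
  comp : ∀ α β γ, α < β → β < γ → γ ≤ κ.ord →
    M.embs α γ = {k | ∃ f ∈ M.embs β γ, ∃ g ∈ M.embs α β, k = embComp M.gap1 (M.len α) f g}
  succ : ∀ α < κ.ord, IsAmalgamation M.gap1 (M.len α) (M.len (α + 1)) (M.embs α (α + 1))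
  limit : ∀ α ≤ κ.ord, Order.IsSuccLimit α → ∀ β₁ < α, ∀ β₂ < α,
    ∀ f₁ ∈ M.embs β₁ α, ∀ f₂ ∈ M.embs β₂ α,
    ∃ γ, β₁ < γ ∧ β₂ < γ ∧ γ < α ∧ ∃ g ∈ M.embs γ α, ∃ j₁ ∈ M.embs β₁ γ, ∃ j₂ ∈ M.embs β₂ γ,
      f₁ = embComp M.gap1 (M.len β₁) g j₁ ∧ f₂ = embComp M.gap1 (M.len β₂) g j₂
  union_len : ∀ α ≤ κ.ord, Order.IsSuccLimit α →
    Iio (M.len α) = {ζ | ∃ β < α, ∃ f ∈ M.embs β α, ∃ ζ' < M.len β, f.ord ζ' = ζ}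
  union_ht : ∀ α ≤ κ.ord, Order.IsSuccLimit α → ∀ ζ ≤ M.len α,
    Iio (M.gap1.ht ζ) = {τ | ∃ β < α, ∃ f ∈ M.embs β α, ∃ ζ' ≤ M.len β, f.ord ζ' = ζ ∧
      ∃ τ' < M.gap1.ht ζ', f.pt ζ' τ' = τ}
  union_maps : ∀ α ≤ κ.ord, Order.IsSuccLimit α → ∀ ζ ξ, ζ < ξ → ξ ≤ M.len α →
    M.gap1.maps ζ ξ = {c | ∃ β < α, ∃ f ∈ M.embs β α, ∃ ζ' ξ', ζ' < ξ' ∧ ξ' ≤ M.len β ∧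
      f.ord ζ' = ζ ∧ f.ord ξ' = ξ ∧ ∃ b ∈ M.gap1.maps ζ' ξ', f.mor ζ' ξ' b = c}

/-- The gap-1 morass `⟨⟨θ_α⟩, ⟨F'_αβ⟩⟩` induced by a gap-2 morass, where
`F'_αβ = {f ↾ θ_α | f ∈ F_αβ}`.  Its tree order is `≺'`. -/
def Gap2Data.induced (M : Gap2Data.{u}) : Gap1Data.{u} where
  ht := M.len
  maps α β := (fun f : EmbData.{u} => restr (M.len α) f.ord) '' M.embs α β

/-! ### Forcing notions -/

/-- The data of a partially ordered set all of whose elements lie in the ambient type `X`: its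
underlying set and its order relation (relevant only on the underlying set). -/
structure Forcing (X : Type v) where
  carrier : Set X
  le : X → X → Prop

namespace Forcing

variable {X : Type v} {Y : Type w}

/-- `le` is a reflexive and transitive relation on `carrier`, i.e. a partial order in the sense of
forcing. Antisymmetry is not required. -/
def IsForcingOrder (P : Forcing X) : Prop :=
  (∀ p ∈ P.carrier, P.le p p) ∧
  ∀ p ∈ P.carrier, ∀ q ∈ P.carrier, ∀ r ∈ P.carrier, P.le p q → P.le q r → P.le p r

/-- `p` and `q` are compatible in `P`. -/
def Compat (P : Forcing X) (p q : X) : Prop := ∃ r ∈ P.carrier, P.le r p ∧ P.le r q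

/-- `P` satisfies the `μ`-chain condition: every antichain has size less than `μ`. -/
def ChainCondition (P : Forcing X) (μ : Cardinal.{w}) : Prop :=
  ∀ A ⊆ P.carrier, (∀ p ∈ A, ∀ q ∈ A, p ≠ q → ¬ P.Compat p q) →
    Cardinal.lift.{w} #A < Cardinal.lift.{v} μ

/-- `σ : P → Q` is an embedding. -/
structure IsEmb (P : Forcing X) (Q : Forcing Y) (σ : X → Y) : Prop where
  mapsTo : MapsTo σ P.carrier Q.carrier
  mono : ∀ p ∈ P.carrier, ∀ p' ∈ P.carrier, P.le p' p → Q.le (σ p') (σ p)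
  incompat_iff : ∀ p ∈ P.carrier, ∀ p' ∈ P.carrier,
    ¬ P.Compat p p' ↔ ¬ Q.Compat (σ p) (σ p')

/-- `p` is a reduction of `q` to `P` with respect to `σ : P → Q`. -/
def IsReduction (P : Forcing X) (Q : Forcing Y) (σ : X → Y) (p : X) (q : Y) : Prop :=
  p ∈ P.carrier ∧ ∀ p' ∈ P.carrier, P.le p' p → Q.Compat (σ p') q

/-- `σ : P → Q` is a complete embedding. -/
structure IsCompleteEmb (P : Forcing X) (Q : Forcing Y) (σ : X → Y) : Prop extends
    IsEmb P Q σ where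
  exists_reduction : ∀ q ∈ Q.carrier, ∃ p, IsReduction P Q σ p q

end Forcing

/-! ### FS systems along gap-1 morasses -/

/-- The least `η` such that `p ∈ P_{η+1}`. -/
def rank {X : Type v} (P : Ordinal.{u} → Forcing X) (p : X) : Ordinal.{u} :=
  sInf {η | p ∈ (P (η + 1)).carrier}

/-- The map `σ_f = ⋃ {σ_st | s = ⟨α, ν⟩, t = ⟨β, f(ν)⟩}` for `f : ht α → ht β`. The value at `x` is
computed with the least `ν` such that `x ∈ P_{ν+1}`; the maps `σ_st` in the union extend each
other. -/
def unionMap {X : Type v} (P : Ordinal.{u} → Forcing X)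
    (σ : Ordinal.{u} × Ordinal.{u} → Ordinal.{u} × Ordinal.{u} → X → X)
    (α β : Ordinal.{u}) (f : Ordinal.{u} → Ordinal.{u}) (x : X) : X :=
  σ (α, rank P x) (β, f (rank P x)) x

/-- The sequence `⟨P_η | η ≤ top⟩` consists of partial orders, is increasing with respect to
`⊆_⊥` (inclusion such that the identity is an embedding), and is continuous at limits: the
underlying set of `P_l` is the union of the underlying sets of the `P_η` with `η < l`. -/
structure IsForcingChain {X : Type v} (top : Ordinal.{u}) (P : Ordinal.{u} → Forcing X) :
    Prop where
  isForcingOrder : ∀ η ≤ top, (P η).IsForcingOrder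
  incl : ∀ η ν, η ≤ ν → ν ≤ top → Forcing.IsEmb (P η) (P ν) id
  union : ∀ l ≤ top, Order.IsSuccLimit l → (P l).carrier = ⋃ η < l, (P η).carrier

/-- The conditions on the maps `⟨σ_st | s ≺ t⟩` and `⟨e_α | α < len⟩` of an FS system along a gap-1
morass `M` of length `len` with tree order `≺`.

If `s = ⟨α, ν⟩ ≺ t = ⟨β, τ⟩`, then `π_st` is `f ↾ (ν + 1)` for any `f ∈ maps α β` with
`f(ν) = τ`. A limit point of `≺` is an element on a limit level. The map called `h_α` is the
member of `maps α (α+1)` different from the identity. -/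
structure IsFSMaps {X : Type v} (M : Gap1Data.{u}) (len : Ordinal.{u})
    (P : Ordinal.{u} → Forcing X)
    (σ : Ordinal.{u} × Ordinal.{u} → Ordinal.{u} × Ordinal.{u} → X → X)
    (e : Ordinal.{u} → X → X) : Prop where
  isEmb : ∀ s t, M.Prec len s t → Forcing.IsEmb (P (s.2 + 1)) (P (t.2 + 1)) (σ s t)
  injOn : ∀ s t, M.Prec len s t → InjOn (σ s t) (P (s.2 + 1)).carrier
  comm : ∀ r s t, M.Prec len r s → M.Prec len s t → ∀ x ∈ (P (r.2 + 1)).carrier,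
    σ r t x = σ s t (σ r s x)
  limit : ∀ t : Ordinal.{u} × Ordinal.{u}, t.1 ≤ len → t.2 < M.ht t.1 → Order.IsSuccLimit t.1 →
    (P (t.2 + 1)).carrier = {y | ∃ s, M.Prec len s t ∧ y ∈ σ s t '' (P (s.2 + 1)).carrier}
  e_mapsTo : ∀ α < len, MapsTo (e α) (P (M.ht (α + 1))).carrier (P (M.ht α)).carrier
  extend : ∀ s t, M.Prec len s t → ∀ f ∈ M.maps s.1 t.1, f s.2 = t.2 →
    ∀ ν' ≤ s.2, ∀ x ∈ (P (ν' + 1)).carrier, σ s t x = σ (s.1, ν') (t.1, f ν') x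
  map_id : ∀ s t, M.Prec len s t → ∀ f ∈ M.maps s.1 t.1, f s.2 = t.2 →
    (∀ ξ ≤ s.2, f ξ = ξ) → ∀ x ∈ (P (s.2 + 1)).carrier, σ s t x = x
  id_complete : ∀ α < len,
    Forcing.IsCompleteEmb (P (M.ht α)) (P (M.ht (α + 1))) id ∧
    ∀ p ∈ (P (M.ht (α + 1))).carrier,
      Forcing.IsReduction (P (M.ht α)) (P (M.ht (α + 1))) id (e α p) p
  h_complete : ∀ α < len, ∀ h ∈ M.maps α (α + 1), h ≠ idOn (M.ht α) →
    Forcing.IsCompleteEmb (P (M.ht α)) (P (M.ht (α + 1))) (unionMap P σ α (α + 1) h) ∧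
    ∀ p ∈ (P (M.ht (α + 1))).carrier,
      Forcing.IsReduction (P (M.ht α)) (P (M.ht (α + 1))) (unionMap P σ α (α + 1) h) (e α p) p
  e_of_mem : ∀ α < len, ∀ p ∈ (P (M.ht α)).carrier, e α p = p
  e_of_range : ∀ α < len, ∀ h ∈ M.maps α (α + 1), h ≠ idOn (M.ht α) →
    ∀ p ∈ (P (M.ht α)).carrier, e α (unionMap P σ α (α + 1) h p) = p

/-- `⟨⟨P_η | η ≤ l⁺⟩, ⟨σ_st | s ≺ t⟩, ⟨e_α | α < l⟩⟩` is an FS system along the simplified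
`(l,1)`-morass `M`. -/
structure IsFSSystem {X : Type v} (M : Gap1Data.{u}) (l : Cardinal.{u})
    (P : Ordinal.{u} → Forcing X)
    (σ : Ordinal.{u} × Ordinal.{u} → Ordinal.{u} × Ordinal.{u} → X → X)
    (e : Ordinal.{u} → X → X) : Prop where
  chain : IsForcingChain (Order.succ l).ord P
  maps : IsFSMaps M l.ord P σ e

/-! ### The function `p*`, the support of `p`, and the derived order `Q`

Here `len` is the length of the gap-1 morass `M` and `P = P_{ht len}`. -/

section Derived

variable {X : Type v} (M : Gap1Data.{u}) (len : Ordinal.{u}) (P : Ordinal.{u} → Forcing X)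
  (σ : Ordinal.{u} × Ordinal.{u} → Ordinal.{u} × Ordinal.{u} → X → X)
  (e : Ordinal.{u} → X → X)

/-- For `q = p_n`: `pull q α x` says that `p^(n)(α)` is defined and equal to `x`. That is,
`x = σ_st⁻¹(q)`, where `t = ⟨len, rank q⟩`, `s ≺ t` is on level `α`, and `q ∈ rng(σ_st)`. -/
def Pull (q : X) (α : Ordinal.{u}) (x : X) : Prop :=
  ∃ ν, M.Prec len (α, ν) (len, rank P q) ∧ x ∈ (P (ν + 1)).carrier ∧
    σ (α, ν) (len, rank P q) x = q

/-- `γ_n(p) = min(dom(p^(n)))` as a function of `q = p_n`. -/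
def minLevel (q : X) : Ordinal.{u} := sInf {α | ∃ x, Pull M len P σ q α x}

/-- `IsIterate p n q` says that `p_n` is defined and equal to `q`: one has `p_0 = p`, and
`p_{n+1} = e_{γ_n(p)-1}(p^(n)(γ_n(p)))` if `γ_n(p) ≠ 0`. -/
def IsIterate (p : X) : ℕ → X → Prop
  | 0, q => q = p
  | n + 1, q => ∃ r β x, IsIterate p n r ∧ minLevel M len P σ r = β + 1 ∧
      Pull M len P σ r (β + 1) x ∧ q = e β x

/-- `supp(p) = {γ_n(p) | n ∈ ω}`. -/
def supp (p : X) : Set Ordinal.{u} :=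
  {γ | ∃ n q, IsIterate M len P σ e p n q ∧ γ = minLevel M len P σ q}

/-- The function `p*`, as a set of ordered pairs: the union of the restrictions of `p^(n)` to
`[γ_n(p), γ_{n-1}(p)[`, where `γ_{-1}(p) = len`. -/
def star (p : X) : Set (Ordinal.{u} × X) :=
  {a | ∃ n q, IsIterate M len P σ e p n q ∧ Pull M len P σ q a.1 a.2 ∧
    minLevel M len P σ q ≤ a.1 ∧ a.1 < len ∧
    ∀ m r, n = m + 1 → IsIterate M len P σ e p m r → a.1 < minLevel M len P σ r}

/-- `p* ↾ supp(p)`. -/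
def starSupp (p : X) : Set (Ordinal.{u} × X) :=
  {a | a ∈ star M len P σ e p ∧ a.1 ∈ supp M len P σ e p}

/-- The domain of a function given as a set of ordered pairs. -/
def dom (q : Set (Ordinal.{u} × X)) : Set Ordinal.{u} := Prod.fst '' q

/-- The derived order `Q = {p* ↾ supp(p) | p ∈ P}`, where `p ≤ q` iff `dom(q) ⊆ dom(p)` and
`p(α) ≤ q(α)` in `P_{ht α}` for all `α ∈ dom(q)`. -/
def derived : Forcing (Set (Ordinal.{u} × X)) where
  carrier := starSupp M len P σ e '' (P (M.ht len)).carrier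
  le p q := dom q ⊆ dom p ∧
    ∀ α x y, (α, x) ∈ p → (α, y) ∈ q → (P (M.ht α)).le x y

/-- `Q_γ = {p ∈ Q | dom(p) ⊆ γ}`, with the order of `Q`. -/
def derivedBelow (γ : Ordinal.{u}) : Forcing (Set (Ordinal.{u} × X)) where
  carrier := {q | q ∈ (derived M len P σ e).carrier ∧ dom q ⊆ Iio γ}
  le := (derived M len P σ e).le

end Derived

/-! ### FS systems along gap-2 morasses -/

/-- `⟨⟨P_η | η ≤ κ⁺⁺⟩, ⟨σ_st | s ≺ t⟩, ⟨σ'_st | s ≺' t⟩, ⟨e_α | α < κ⁺⟩, ⟨e'_α | α < κ⟩⟩` is an FS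
system along the simplified `(κ,2)`-morass `M`. The conditions on `σ'` and `e'` are those of an FS
system along the induced morass `⟨⟨θ_α⟩, ⟨F'_αβ⟩⟩`, with the orders `Q_η` in place of `P_η`; the
member of `F'_{α,α+1}` different from the identity is the restriction to `θ_α` of the unique
right-branching embedding in `F_{α,α+1}`. -/
structure IsFSSystem₂ {X : Type v} (M : Gap2Data.{u}) (κ : Cardinal.{u})
    (P : Ordinal.{u} → Forcing X)
    (σ : Ordinal.{u} × Ordinal.{u} → Ordinal.{u} × Ordinal.{u} → X → X)
    (σ' : Ordinal.{u} × Ordinal.{u} → Ordinal.{u} × Ordinal.{u} →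
      Set (Ordinal.{u} × X) → Set (Ordinal.{u} × X))
    (e : Ordinal.{u} → X → X)
    (e' : Ordinal.{u} → Set (Ordinal.{u} × X) → Set (Ordinal.{u} × X)) : Prop where
  gap1 : IsFSSystem M.gap1 (Order.succ κ) P σ e
  maps' : IsFSMaps M.induced κ.ord
    (derivedBelow M.gap1 (Order.succ κ).ord P σ e) σ' e'

end Morass

end

/-!
The proof of both parts rests on one lemma about an FS system along a gap-1 morass. Descending
through the levels, a condition `p` of the top order leaves on each level `α` a trace
`p*(α) ∈ P_{φ_α}`, with `p*(len) = p` and `p*(α) = e_α(p*(α + 1))`. If `α + 1` is not in the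
support, then `p*(α + 1)` is the image of `p*(α)` under the identity or under `σ_α`
(`trace_add_one`); and on a limit level, the trace is the image of the traces on all large smaller
levels (`trace_limit`). Hence compatibility of the traces of `p` and `q` climbs up as long as no
level in both supports is met (`compat_trace`): at a successor level not in the support of `p`,
`p*(α + 1)` is an image of `p*(α)`, while `q*(α)` is a reduction of `q*(α + 1)`; at a limit level,
directedness gives a single map of the morass that carries both traces up.

For (a), a common extension of `p* ↾ supp(p)` and `q* ↾ supp(q)` in the derived order makes the
traces compatible on every level in both supports, the level `0` being one. So `p` and `q` are
compatible (`compat_of_compat_starSupp`), and antichains of `P` yield antichains of `Q`.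

For (b), it suffices by (a) to show that `Q` satisfies the chain condition. The orders `Q_η` form an
FS system along the induced gap-1 morass of length `κ`: the conditions on the maps hold by
assumption, and the `Q_η` form a chain because supports are finite and elements of `Q` may be
restricted (`isForcingChain_derivedBelow`). Given `μ` conditions of `Q`, which now have finite
supports contained in `κ`, there are `α < κ` and `μ` many of the conditions whose supports are
pairwise disjoint above `α`: if `cf(μ) ≠ κ`, the supports of `μ` many conditions are even bounded
below `κ`, and if `μ = κ`, this is a `Δ`-system argument. The chain condition for `Q_{θ_α}` gives
two of them whose traces at `α` are compatible, and these two conditions are compatible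
(`chainCondition_top`).
-/

namespace Morass

/-! ### The combinatorics of gap-1 morasses -/

lemma restr_apply {a ξ : Ordinal.{u}} (h : ξ < a) (f : Ordinal.{u} → Ordinal.{u}) :
    restr a f ξ = f ξ := if_pos h

lemma restr_of_le {a ξ : Ordinal.{u}} (h : a ≤ ξ) (f : Ordinal.{u} → Ordinal.{u}) :
    restr a f ξ = 0 := if_neg h.not_gt

lemma idOn_apply {a ξ : Ordinal.{u}} (h : ξ < a) : idOn a ξ = ξ := restr_apply h _

lemma compOn_apply {a ξ : Ordinal.{u}} (h : ξ < a) (f g : Ordinal.{u} → Ordinal.{u}) :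
    compOn a f g ξ = f (g ξ) := restr_apply h _

lemma IsOrderMap.lt {a b ξ : Ordinal.{u}} {f : Ordinal.{u} → Ordinal.{u}}
    (hf : IsOrderMap a b f) (h : ξ < a) : f ξ < b := hf.mapsTo h

lemma IsOrderMap.le_apply {a b : Ordinal.{u}} {f : Ordinal.{u} → Ordinal.{u}}
    (hf : IsOrderMap a b f) (ξ : Ordinal.{u}) : ξ < a → ξ ≤ f ξ := by
  induction ξ using WellFoundedLT.induction with
  | ind ξ ih =>
    intro h
    by_contra! h'
    have h1 := ih (f ξ) h' (h'.trans h)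
    exact absurd (hf.strictMono (h'.trans h) h h') h1.not_gt

lemma IsOrderMap.le_iff_le {a b ξ ζ : Ordinal.{u}} {f : Ordinal.{u} → Ordinal.{u}}
    (hf : IsOrderMap a b f) (h : ξ < a) (h' : ζ < a) : f ξ ≤ f ζ ↔ ξ ≤ ζ :=
  hf.strictMono.le_iff_le h h'

lemma IsOrderMap.lt_iff_lt {a b ξ ζ : Ordinal.{u}} {f : Ordinal.{u} → Ordinal.{u}}
    (hf : IsOrderMap a b f) (h : ξ < a) (h' : ζ < a) : f ξ < f ζ ↔ ξ < ζ :=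
  hf.strictMono.lt_iff_lt h h'

lemma IsOrderMap.inj {a b ξ ζ : Ordinal.{u}} {f : Ordinal.{u} → Ordinal.{u}}
    (hf : IsOrderMap a b f) (h : ξ < a) (h' : ζ < a) (he : f ξ = f ζ) : ξ = ζ :=
  hf.strictMono.injOn h h' he

lemma zero_or_add_one_or_isSuccLimit (a : Ordinal.{u}) :
    a = 0 ∨ (∃ b, a = b + 1) ∨ Order.IsSuccLimit a := by
  rcases Ordinal.zero_or_succ_or_isSuccLimit a with h | ⟨b, h⟩ | h
  · exact Or.inl h
  · exact Or.inr (Or.inl ⟨b, by rw [← h, Order.succ_eq_add_one]⟩)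
  · exact Or.inr (Or.inr h)

/-- The axioms of a simplified gap-1 morass of length `len` that concern neither the value of
`ht 0` nor the sizes of the `ht α` and of the sets `maps α β`. They are shared by the gap-1 part of
a gap-2 morass and by the induced morass, and they suffice for the arguments about FS systems. -/
structure Gap1Data.IsPremorass (M : Gap1Data.{u}) (len : Ordinal.{u}) : Prop where
  isSuccLimit_len : Order.IsSuccLimit len
  ht_pos : ∀ α ≤ len, 0 < M.ht α
  isOrderMap : ∀ α β, α < β → β ≤ len → ∀ f ∈ M.maps α β, IsOrderMap (M.ht α) (M.ht β) f
  comp : ∀ α β γ, α < β → β < γ → γ ≤ len →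
    M.maps α γ = {k | ∃ f ∈ M.maps β γ, ∃ g ∈ M.maps α β, k = compOn (M.ht α) f g}
  succ : ∀ α < len, ∃ h δ, δ < M.ht α ∧ (∀ ξ < δ, h ξ = ξ) ∧ M.ht α ≤ h δ ∧
    M.maps α (α + 1) = {idOn (M.ht α), h}
  limit : ∀ α ≤ len, Order.IsSuccLimit α → ∀ β₁ < α, ∀ β₂ < α,
    ∀ f₁ ∈ M.maps β₁ α, ∀ f₂ ∈ M.maps β₂ α,
    ∃ γ, β₁ < γ ∧ β₂ < γ ∧ γ < α ∧ ∃ g ∈ M.maps γ α, ∃ j₁ ∈ M.maps β₁ γ, ∃ j₂ ∈ M.maps β₂ γ,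
      f₁ = compOn (M.ht β₁) g j₁ ∧ f₂ = compOn (M.ht β₂) g j₂
  union : ∀ α ≤ len, Order.IsSuccLimit α → ∀ τ < M.ht α,
    ∃ β < α, ∃ f ∈ M.maps β α, ∃ ξ < M.ht β, f ξ = τ

namespace Gap1Data.IsPremorass

variable {M : Gap1Data.{u}} {len : Ordinal.{u}}

lemma comp_mem (hM : M.IsPremorass len) {α β γ : Ordinal.{u}} (h1 : α < β) (h2 : β < γ)
    (h3 : γ ≤ len) {f g : Ordinal.{u} → Ordinal.{u}} (hf : f ∈ M.maps β γ) (hg : g ∈ M.maps α β) :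
    compOn (M.ht α) f g ∈ M.maps α γ := by
  rw [hM.comp α β γ h1 h2 h3]
  exact ⟨f, hf, g, hg, rfl⟩

lemma exists_factor (hM : M.IsPremorass len) {α β γ : Ordinal.{u}} (h1 : α < β) (h2 : β < γ)
    (h3 : γ ≤ len) {k : Ordinal.{u} → Ordinal.{u}} (hk : k ∈ M.maps α γ) :
    ∃ f ∈ M.maps β γ, ∃ g ∈ M.maps α β, ∀ ξ < M.ht α, k ξ = f (g ξ) := by
  rw [hM.comp α β γ h1 h2 h3] at hk
  obtain ⟨f, hf, g, hg, rfl⟩ := hk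
  exact ⟨f, hf, g, hg, fun ξ hξ => compOn_apply hξ _ _⟩

lemma exists_common (hM : M.IsPremorass len) {α : Ordinal.{u}} (hα : α ≤ len)
    (hl : Order.IsSuccLimit α) {β₁ β₂ : Ordinal.{u}} (h1 : β₁ < α) (h2 : β₂ < α)
    {f₁ f₂ : Ordinal.{u} → Ordinal.{u}} (hf₁ : f₁ ∈ M.maps β₁ α) (hf₂ : f₂ ∈ M.maps β₂ α) :
    ∃ γ, β₁ < γ ∧ β₂ < γ ∧ γ < α ∧ ∃ g ∈ M.maps γ α, ∃ j₁ ∈ M.maps β₁ γ, ∃ j₂ ∈ M.maps β₂ γ,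
      (∀ ξ < M.ht β₁, f₁ ξ = g (j₁ ξ)) ∧ (∀ ξ < M.ht β₂, f₂ ξ = g (j₂ ξ)) := by
  obtain ⟨γ, h3, h4, h5, g, hg, j₁, hj₁, j₂, hj₂, e1, e2⟩ :=
    hM.limit α hα hl β₁ h1 β₂ h2 f₁ hf₁ f₂ hf₂
  refine ⟨γ, h3, h4, h5, g, hg, j₁, hj₁, j₂, hj₂, ?_, ?_⟩
  · intro ξ hξ; rw [e1, compOn_apply hξ]
  · intro ξ hξ; rw [e2, compOn_apply hξ]

lemma nonempty_maps (hM : M.IsPremorass len) (β : Ordinal.{u}) :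
    β ≤ len → ∀ α < β, (M.maps α β).Nonempty := by
  induction β using WellFoundedLT.induction with
  | ind β ih =>
    intro hβ α hα
    rcases zero_or_add_one_or_isSuccLimit β with h | ⟨γ, rfl⟩ | h
    · exact absurd hα (by simp [h])
    · have hγ : γ < γ + 1 := lt_add_one γ
      obtain ⟨h, δ, -, -, -, hm⟩ := hM.succ γ (hγ.trans_le hβ)
      have h0 : idOn (M.ht γ) ∈ M.maps γ (γ + 1) := by simp [hm]
      rcases (Order.lt_add_one_iff.1 hα).eq_or_lt with rfl | h'
      · exact ⟨_, h0⟩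
      · obtain ⟨g, hg⟩ := ih γ hγ (hγ.le.trans hβ) α h'
        exact ⟨_, hM.comp_mem h' hγ hβ h0 hg⟩
    · obtain ⟨γ, hγ, f, hf, -⟩ := hM.union β hβ h 0 (hM.ht_pos β hβ)
      rcases lt_trichotomy α γ with h1 | rfl | h1
      · obtain ⟨g, hg⟩ := ih γ hγ (hγ.le.trans hβ) α h1
        exact ⟨_, hM.comp_mem h1 hγ hβ hf hg⟩
      · exact ⟨f, hf⟩
      · obtain ⟨g, hg, -⟩ := hM.exists_factor h1 hα hβ hf
        exact ⟨g, hg⟩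

/-- A node of the tree has at most one predecessor on each level. -/
lemma eq_of_apply_eq (hM : M.IsPremorass len) (β : Ordinal.{u}) :
    β ≤ len → ∀ α < β, ∀ f₁ ∈ M.maps α β, ∀ f₂ ∈ M.maps α β, ∀ ν₁ < M.ht α, ∀ ν₂ < M.ht α,
      f₁ ν₁ = f₂ ν₂ → ν₁ = ν₂ := by
  induction β using WellFoundedLT.induction with
  | ind β ih =>
    intro hβ α hα f₁ hf₁ f₂ hf₂ ν₁ hν₁ ν₂ hν₂ he
    rcases zero_or_add_one_or_isSuccLimit β with h | ⟨γ, rfl⟩ | h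
    · exact absurd hα (by simp [h])
    · have hγ : γ < γ + 1 := lt_add_one γ
      have key : ∀ k₁ ∈ M.maps γ (γ + 1), ∀ k₂ ∈ M.maps γ (γ + 1), ∀ ν₁ < M.ht γ, ∀ ν₂ < M.ht γ,
          k₁ ν₁ = k₂ ν₂ → ν₁ = ν₂ := by
        intro k₁ hk₁ k₂ hk₂ ν₁ hν₁ ν₂ hν₂ he
        have o₁ := hM.isOrderMap _ _ hγ hβ k₁ hk₁
        have o₂ := hM.isOrderMap _ _ hγ hβ k₂ hk₂
        obtain ⟨h, δ, hδ, hlt, hge, hm⟩ := hM.succ γ (hγ.trans_le hβ)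
        -- The two maps differ only from the split point on, where the second one exceeds `ht γ`.
        have aux : ∀ ν₁ < M.ht γ, ∀ ν₂ < M.ht γ, IsOrderMap (M.ht γ) (M.ht (γ + 1)) h →
            ν₁ = h ν₂ → ν₁ = ν₂ := by
          intro ν₁ hν₁ ν₂ hν₂ oh he
          by_cases hc : ν₂ < δ
          · rw [he, hlt _ hc]
          · have := (oh.le_iff_le hδ hν₂).2 (not_lt.1 hc)
            exact absurd (hge.trans this) (by rw [← he]; exact hν₁.not_ge)
        rw [hm] at hk₁ hk₂
        rcases hk₁ with rfl | rfl <;> rcases hk₂ with rfl | rfl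
        · exact o₁.inj hν₁ hν₂ he
        · rw [idOn_apply hν₁] at he
          exact aux _ hν₁ _ hν₂ o₂ he
        · rw [idOn_apply hν₂] at he
          exact (aux _ hν₂ _ hν₁ o₁ he.symm).symm
        · exact o₁.inj hν₁ hν₂ he
      rcases (Order.lt_add_one_iff.1 hα).eq_or_lt with rfl | h'
      · exact key _ hf₁ _ hf₂ _ hν₁ _ hν₂ he
      · obtain ⟨k₁, hk₁, g₁, hg₁, e₁⟩ := hM.exists_factor h' hγ hβ hf₁
        obtain ⟨k₂, hk₂, g₂, hg₂, e₂⟩ := hM.exists_factor h' hγ hβ hf₂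
        have hγ' := hγ.le.trans hβ
        refine ih γ hγ hγ' α h' g₁ hg₁ g₂ hg₂ ν₁ hν₁ ν₂ hν₂ ?_
        refine key _ hk₁ _ hk₂ _ ((hM.isOrderMap _ _ h' hγ' _ hg₁).lt hν₁) _
          ((hM.isOrderMap _ _ h' hγ' _ hg₂).lt hν₂) ?_
        rw [← e₁ _ hν₁, ← e₂ _ hν₂, he]
    · obtain ⟨γ, h1, -, h3, g, hg, j₁, hj₁, j₂, hj₂, e1, e2⟩ := hM.exists_common hβ h hα hα hf₁ hf₂
      have hγ' := h3.le.trans hβ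
      refine ih γ h3 hγ' α h1 j₁ hj₁ j₂ hj₂ ν₁ hν₁ ν₂ hν₂ ?_
      refine (hM.isOrderMap _ _ h3 hβ g hg).inj ((hM.isOrderMap _ _ h1 hγ' _ hj₁).lt hν₁)
        ((hM.isOrderMap _ _ h1 hγ' _ hj₂).lt hν₂) ?_
      rw [← e1 _ hν₁, ← e2 _ hν₂, he]

/-- The identity on each proper initial segment of `ht α` extends to a member of `maps α β`, and a
member of `maps α β` sends each ordinal to itself or beyond `ht α`. At a limit level, each of the
two facts depends on the other one at smaller arguments or levels. -/
lemma exists_id_and_apply_eq_or_le (hM : M.IsPremorass len) (β : Ordinal.{u}) :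
    β ≤ len → ∀ α < β,
      (∀ ν < M.ht α, ∃ f ∈ M.maps α β, ∀ ξ ≤ ν, f ξ = ξ) ∧
      (∀ f ∈ M.maps α β, ∀ ξ < M.ht α, f ξ = ξ ∨ M.ht α ≤ f ξ) := by
  induction β using WellFoundedLT.induction with
  | ind β ih =>
    intro hβ
    rcases zero_or_add_one_or_isSuccLimit β with h | ⟨γ, rfl⟩ | hl
    · intro α hα
      exact absurd hα (by simp [h])
    · intro α hα
      have hγ : γ < γ + 1 := lt_add_one γ
      have hγ' := hγ.le.trans hβ
      obtain ⟨h, δ, hδ, hlt, hge, hm⟩ := hM.succ γ (hγ.trans_le hβ)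
      have hid : idOn (M.ht γ) ∈ M.maps γ (γ + 1) := by simp [hm]
      have key : ∀ f ∈ M.maps γ (γ + 1), ∀ ξ < M.ht γ, f ξ = ξ ∨ M.ht γ ≤ f ξ := by
        intro f hf ξ hξ
        have o := hM.isOrderMap _ _ hγ hβ f hf
        rw [hm] at hf
        rcases hf with rfl | rfl
        · exact Or.inl (idOn_apply hξ)
        · by_cases hc : ξ < δ
          · exact Or.inl (hlt _ hc)
          · exact Or.inr (hge.trans ((o.le_iff_le hδ hξ).2 (not_lt.1 hc)))
      rcases (Order.lt_add_one_iff.1 hα).eq_or_lt with rfl | h'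
      · exact ⟨fun ν hν => ⟨_, hid, fun ξ hξ => idOn_apply (hξ.trans_lt hν)⟩, key⟩
      · obtain ⟨i1, i2⟩ := ih γ hγ hγ' α h'
        refine ⟨fun ν hν => ?_, fun f hf ξ hξ => ?_⟩
        · obtain ⟨f, hf, hfe⟩ := i1 ν hν
          refine ⟨_, hM.comp_mem h' hγ hβ hid hf, fun ξ hξ => ?_⟩
          have hξ' := hξ.trans_lt hν
          rw [compOn_apply hξ', idOn_apply ((hM.isOrderMap _ _ h' hγ' _ hf).lt hξ'), hfe _ hξ]
        · obtain ⟨k, hk, g, hg, e⟩ := hM.exists_factor h' hγ hβ hf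
          have og := hM.isOrderMap _ _ h' hγ' _ hg
          rw [e _ hξ]
          rcases key k hk (g ξ) (og.lt hξ) with h1 | h1
          · rw [h1]; exact i2 g hg ξ hξ
          · right
            refine le_trans ?_ h1
            by_contra! hc
            obtain ⟨f, hf, hfe⟩ := i1 _ hc
            exact absurd ((hM.isOrderMap _ _ h' hγ' _ hf).lt hc) (by simp [hfe _ le_rfl])
    · have fixed : ∀ ν : Ordinal.{u}, ∀ γ < β, ν < M.ht γ → ∃ f ∈ M.maps γ β, f ν = ν := by
        intro ν
        induction ν using WellFoundedLT.induction with
        | ind ν ihν =>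
          intro γ hγ hν
          obtain ⟨f₀, hf₀⟩ := hM.nonempty_maps β hβ γ hγ
          have of₀ := hM.isOrderMap _ _ hγ hβ _ hf₀
          obtain ⟨γ', hγ', g, hg, x, hx, hgx⟩ :=
            hM.union β hβ hl ν ((of₀.le_apply ν hν).trans_lt (of₀.lt hν))
          obtain ⟨γ₂, h1, h2, h3, g₂, hg₂, j₁, hj₁, j₂, hj₂, -, e2⟩ :=
            hM.exists_common hβ hl hγ hγ' hf₀ hg
          have h3' := h3.le.trans hβ
          have oj₁ := hM.isOrderMap _ _ h1 h3' _ hj₁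
          have og₂ := hM.isOrderMap _ _ h3 hβ _ hg₂
          have hx₂ : j₂ x < M.ht γ₂ := (hM.isOrderMap _ _ h2 h3' _ hj₂).lt hx
          have hgx₂ : g₂ (j₂ x) = ν := by rw [← e2 _ hx, hgx]
          generalize j₂ x = y at hx₂ hgx₂
          have hνγ₂ : ν < M.ht γ₂ := (oj₁.le_apply ν hν).trans_lt (oj₁.lt hν)
          have hyν : y ≤ ν := (og₂.le_apply y hx₂).trans hgx₂.le
          rcases hyν.eq_or_lt with rfl | hlt
          · obtain ⟨j, hj, hje⟩ := (ih γ₂ h3 h3' γ h1).1 y hν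
            exact ⟨_, hM.comp_mem h1 h3 hβ hg₂ hj, by
              rw [compOn_apply hν, hje _ le_rfl, hgx₂]⟩
          · -- A node below `⟨β, ν⟩` other than `⟨γ₂, ν⟩` would be moved later, hence beyond `ν`.
            obtain ⟨f', hf', hfy⟩ := ihν y hlt γ₂ h3 hx₂
            obtain ⟨γ₃, h4, -, h5, k, hk, i₁, hi₁, i₂, hi₂, e3, e4⟩ :=
              hM.exists_common hβ hl h3 h3 hf' hg₂
            have h5' := h5.le.trans hβ
            have ok := hM.isOrderMap _ _ h5 hβ _ hk
            have oi₁ := hM.isOrderMap _ _ h4 h5' _ hi₁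
            have oi₂ := hM.isOrderMap _ _ h4 h5' _ hi₂
            have hi₁y : i₁ y = y := by
              refine le_antisymm ?_ (oi₁.le_apply y hx₂)
              refine (ok.le_apply _ (oi₁.lt hx₂)).trans ?_
              rw [← e3 _ hx₂, hfy]
            have hky : k y = y := by rw [← hi₁y, ← e3 _ hx₂, hfy, hi₁y]
            have hi₂y := ok.le_apply _ (oi₂.lt hx₂)
            rw [← e4 _ hx₂, hgx₂] at hi₂y
            rcases (ih γ₃ h5 h5' γ₂ h4).2 i₂ hi₂ y hx₂ with h6 | h6
            · have := e4 _ hx₂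
              rw [h6, hky, hgx₂] at this
              exact absurd this hlt.ne'
            · exact absurd (h6.trans hi₂y) hνγ₂.not_ge
      have move : ∀ α < β, ∀ f ∈ M.maps α β, ∀ ξ < M.ht α, f ξ = ξ ∨ M.ht α ≤ f ξ := by
        intro α hα f hf ξ hξ
        obtain ⟨f', hf', hfξ⟩ := fixed ξ α hα hξ
        obtain ⟨γ, h4, -, h5, k, hk, i₁, hi₁, i₂, hi₂, e3, e4⟩ :=
          hM.exists_common hβ hl hα hα hf' hf
        have h5' := h5.le.trans hβ
        have ok := hM.isOrderMap _ _ h5 hβ _ hk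
        have oi₁ := hM.isOrderMap _ _ h4 h5' _ hi₁
        have oi₂ := hM.isOrderMap _ _ h4 h5' _ hi₂
        have hi₁ξ : i₁ ξ = ξ := by
          refine le_antisymm ?_ (oi₁.le_apply ξ hξ)
          refine (ok.le_apply _ (oi₁.lt hξ)).trans ?_
          rw [← e3 _ hξ, hfξ]
        have hkξ : k ξ = ξ := by rw [← hi₁ξ, ← e3 _ hξ, hfξ, hi₁ξ]
        rw [e4 _ hξ]
        rcases (ih γ h5 h5' α h4).2 i₂ hi₂ ξ hξ with h6 | h6
        · left; rw [h6, hkξ]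
        · right; exact h6.trans (ok.le_apply _ (oi₂.lt hξ))
      intro α hα
      refine ⟨fun ν hν => ?_, move α hα⟩
      obtain ⟨f, hf, hfν⟩ := fixed ν α hα hν
      refine ⟨f, hf, fun ξ hξ => ?_⟩
      have hξ' := hξ.trans_lt hν
      refine (move α hα f hf ξ hξ').resolve_right fun h => ?_
      have := ((hM.isOrderMap _ _ hα hβ f hf).le_iff_le hξ' hν).2 hξ
      exact absurd (h.trans (this.trans hfν.le)) hν.not_ge

lemma exists_id (hM : M.IsPremorass len) {α β ν : Ordinal.{u}} (hα : α < β) (hβ : β ≤ len)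
    (hν : ν < M.ht α) : ∃ f ∈ M.maps α β, ∀ ξ ≤ ν, f ξ = ξ :=
  (hM.exists_id_and_apply_eq_or_le β hβ α hα).1 ν hν

lemma ht_mono (hM : M.IsPremorass len) {α β : Ordinal.{u}} (h : α ≤ β) (hβ : β ≤ len) :
    M.ht α ≤ M.ht β := by
  rcases h.eq_or_lt with rfl | h
  · rfl
  · by_contra! hc
    obtain ⟨f, hf, he⟩ := hM.exists_id h hβ hc
    have := (hM.isOrderMap _ _ h hβ f hf).lt hc
    rw [he _ le_rfl] at this
    exact this.false

lemma prec_trans (hM : M.IsPremorass len) {r s t : Ordinal.{u} × Ordinal.{u}}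
    (h1 : M.Prec len r s) (h2 : M.Prec len s t) : M.Prec len r t := by
  obtain ⟨a1, -, a3, a4, f, hf, hfe⟩ := h1
  obtain ⟨b1, b2, b3, b4, g, hg, hge⟩ := h2
  exact ⟨a1.trans b1, b2, a3, b4, _, hM.comp_mem a1 b1 b2 hg hf, by
    rw [compOn_apply a3, hfe, hge]⟩

lemma prec_unique (hM : M.IsPremorass len) {α ν₁ ν₂ : Ordinal.{u}} {t : Ordinal.{u} × Ordinal.{u}}
    (h1 : M.Prec len (α, ν₁) t) (h2 : M.Prec len (α, ν₂) t) : ν₁ = ν₂ := by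
  obtain ⟨a1, a2, a3, a4, f, hf, hfe⟩ := h1
  obtain ⟨b1, b2, b3, b4, g, hg, hge⟩ := h2
  exact hM.eq_of_apply_eq _ a2 _ a1 f hf g hg _ a3 _ b3 (hfe.trans hge.symm)

/-- Between two nodes `r ≺ t` there is one on each intermediate level. -/
lemma prec_between (hM : M.IsPremorass len) {β : Ordinal.{u}} {r t : Ordinal.{u} × Ordinal.{u}}
    (h : M.Prec len r t) (h1 : r.1 < β) (h2 : β < t.1) :
    ∃ ν, M.Prec len r (β, ν) ∧ M.Prec len (β, ν) t := by
  obtain ⟨a1, a2, a3, a4, f, hf, hfe⟩ := h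
  obtain ⟨g, hg, j, hj, e⟩ := hM.exists_factor h1 h2 a2 hf
  have := (hM.isOrderMap _ _ h1 (h2.le.trans a2) j hj).lt a3
  exact ⟨j r.2, ⟨h1, h2.le.trans a2, a3, this, j, hj, rfl⟩,
    ⟨h2, a2, this, a4, g, hg, by rw [← hfe, e _ a3]⟩⟩

end Gap1Data.IsPremorass

/-! ### Forcing notions -/

namespace Forcing

variable {X : Type v} {Y : Type w}

lemma Compat.symm {P : Forcing X} {p q : X} (h : P.Compat p q) : P.Compat q p := by
  obtain ⟨r, hr, h1, h2⟩ := h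
  exact ⟨r, hr, h2, h1⟩

lemma IsEmb.compat_iff {P : Forcing X} {Q : Forcing Y} {f : X → Y} (hf : IsEmb P Q f) {p q : X}
    (hp : p ∈ P.carrier) (hq : q ∈ P.carrier) : P.Compat p q ↔ Q.Compat (f p) (f q) :=
  not_iff_not.1 (hf.incompat_iff p hp q hq)

/-- If `q'` is a reduction of `q` with respect to `f` and is compatible with `p`, then `f p` is
compatible with `q`. -/
lemma IsReduction.compat {P : Forcing X} {Q : Forcing Y} {f : X → Y} (hQ : Q.IsForcingOrder)
    (hf : IsEmb P Q f) {p q' : X} {q : Y} (hp : p ∈ P.carrier)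
    (hr : IsReduction P Q f q' q) (h : P.Compat p q') : Q.Compat (f p) q := by
  obtain ⟨r, hrP, h1, h2⟩ := h
  obtain ⟨s, hs, h3, h4⟩ := hr.2 r hrP h2
  exact ⟨s, hs, hQ.2 _ hs _ (hf.mapsTo hrP) _ (hf.mapsTo hp) h3 (hf.mono _ hp _ hrP h1), h4⟩

lemma IsForcingOrder.compat_self {P : Forcing X} (hP : P.IsForcingOrder) {p : X}
    (hp : p ∈ P.carrier) : P.Compat p p :=
  ⟨p, hp, hP.1 p hp, hP.1 p hp⟩

/-- The `μ`-chain condition in terms of indexed families of `μ` conditions, repetitions allowed. -/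
lemma IsForcingOrder.chainCondition_iff {P : Forcing X} (hP : P.IsForcingOrder)
    {μ : Cardinal.{w}} : P.ChainCondition μ ↔ ∀ (I : Type w) (a : I → X), #I = μ →
      (∀ i, a i ∈ P.carrier) → ∃ i j, i ≠ j ∧ P.Compat (a i) (a j) := by
  constructor
  · intro h I a hI ha
    by_contra! hc
    have hinj : Function.Injective a := by
      intro i j hij
      by_contra hne
      exact hc i j hne (hij ▸ hP.compat_self (ha i))
    have := h (range a) (range_subset_iff.2 ha) (by
      rintro _ ⟨i, rfl⟩ _ ⟨j, rfl⟩ hne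
      exact hc i j fun h => hne (by rw [h]))
    rw [Cardinal.mk_range_eq_of_injective hinj, hI] at this
    exact this.false
  · intro h A hA hinc
    by_contra! hc
    rw [← Cardinal.mk_out μ, Cardinal.lift_mk_le'] at hc
    obtain ⟨g⟩ := hc
    obtain ⟨i, j, hij, hcomp⟩ := h μ.out (fun i => g i) (Cardinal.mk_out μ) fun i => hA (g i).2
    exact hinc _ (g i).2 _ (g j).2 (fun h => hij (g.injective (Subtype.ext h))) hcomp

/-- The chain condition passes from `Q` to `P` along a map that reflects compatibility. -/
lemma ChainCondition.of_reflects {P : Forcing X} {Q : Forcing Y} {μ : Cardinal.{u}}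
    (hP : P.IsForcingOrder) (hQ : Q.IsForcingOrder) (hcc : Q.ChainCondition μ) (f : X → Y)
    (hf : MapsTo f P.carrier Q.carrier)
    (hc : ∀ p ∈ P.carrier, ∀ q ∈ P.carrier, Q.Compat (f p) (f q) → P.Compat p q) :
    P.ChainCondition μ := by
  refine hP.chainCondition_iff.2 fun I a hI ha => ?_
  obtain ⟨i, j, hij, h⟩ := hQ.chainCondition_iff.1 hcc I (f ∘ a) hI fun i => hf (ha i)
  exact ⟨i, j, hij, hc _ (ha i) _ (ha j) h⟩

end Forcing

/-! ### Traces of a condition on the levels of the morass -/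

section System

variable {X : Type v}

/-- `P`, `σ` and `e` form an FS system along the premorass `M` of length `len`, where the orders
`P η` are indexed by the ordinals `η ≤ ht len`. -/
structure IsFSPresystem (M : Gap1Data.{u}) (len : Ordinal.{u}) (P : Ordinal.{u} → Forcing X)
    (σ : Ordinal.{u} × Ordinal.{u} → Ordinal.{u} × Ordinal.{u} → X → X)
    (e : Ordinal.{u} → X → X) : Prop where
  premorass : M.IsPremorass len
  chain : IsForcingChain (M.ht len) P
  maps : IsFSMaps M len P σ e

namespace IsFSPresystem

variable {M : Gap1Data.{u}} {len : Ordinal.{u}} {P : Ordinal.{u} → Forcing X}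
  {σ : Ordinal.{u} × Ordinal.{u} → Ordinal.{u} × Ordinal.{u} → X → X} {e : Ordinal.{u} → X → X}

lemma mem_mono (hS : IsFSPresystem M len P σ e) {η ν : Ordinal.{u}} (h : η ≤ ν)
    (hν : ν ≤ M.ht len) {x : X} (hx : x ∈ (P η).carrier) : x ∈ (P ν).carrier :=
  (hS.chain.incl η ν h hν).mapsTo hx

lemma compat_iff (hS : IsFSPresystem M len P σ e) {η ν : Ordinal.{u}} (h : η ≤ ν)
    (hν : ν ≤ M.ht len) {x y : X} (hx : x ∈ (P η).carrier) (hy : y ∈ (P η).carrier) :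
    (P η).Compat x y ↔ (P ν).Compat x y :=
  (hS.chain.incl η ν h hν).compat_iff hx hy

lemma add_one_le_ht (hS : IsFSPresystem M len P σ e) {α ν : Ordinal.{u}} (h : ν < M.ht α)
    (hα : α ≤ len) : ν + 1 ≤ M.ht len :=
  (Order.add_one_le_of_lt h).trans (hS.premorass.ht_mono hα le_rfl)

lemma rank_le {η : Ordinal.{u}} {x : X} (hx : x ∈ (P (η + 1)).carrier) : rank P x ≤ η :=
  csInf_le' hx

lemma rank_spec (hS : IsFSPresystem M len P σ e) {η : Ordinal.{u}} (h0 : 0 < η)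
    (hη : η ≤ M.ht len) {x : X} (hx : x ∈ (P η).carrier) :
    x ∈ (P (rank P x + 1)).carrier ∧ rank P x < η := by
  have : ∃ ζ < η, x ∈ (P (ζ + 1)).carrier := by
    rcases zero_or_add_one_or_isSuccLimit η with h | ⟨ζ, rfl⟩ | h
    · exact absurd h h0.ne'
    · exact ⟨ζ, lt_add_one ζ, hx⟩
    · rw [hS.chain.union η hη h] at hx
      simp only [mem_iUnion] at hx
      obtain ⟨ζ, hζ, hx⟩ := hx
      exact ⟨ζ, hζ, hS.mem_mono (lt_add_one ζ).le ((Order.add_one_le_of_lt hζ).trans hη) hx⟩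
  obtain ⟨ζ, hζ, hx'⟩ := this
  exact ⟨csInf_mem (s := {η | x ∈ (P (η + 1)).carrier}) ⟨ζ, hx'⟩, (rank_le hx').trans_lt hζ⟩

/-- If `σ_st(x)` has the largest possible rank `ν(t)`, then `x` has rank `ν(s)`: as the maps extend
each other, an argument of smaller rank would have a value of smaller rank. -/
lemma rank_of_rank_apply (hS : IsFSPresystem M len P σ e) {s t : Ordinal.{u} × Ordinal.{u}}
    (h : M.Prec len s t) {x : X} (hx : x ∈ (P (s.2 + 1)).carrier)
    (hr : rank P (σ s t x) = t.2) : rank P x = s.2 := by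
  refine (rank_le hx).eq_of_not_lt fun hlt => ?_
  have hxr := (hS.rank_spec (Order.bot_lt_succ s.2) (hS.add_one_le_ht h.2.2.1
    (h.1.le.trans h.2.1)) hx).1
  obtain ⟨h1, h2, h3, h4, f, hf, hfe⟩ := h
  have of := hS.premorass.isOrderMap _ _ h1 h2 f hf
  have h5 : rank P x < M.ht s.1 := hlt.trans h3
  have hext := hS.maps.extend s t ⟨h1, h2, h3, h4, f, hf, hfe⟩ f hf hfe _ hlt.le x hxr
  have hp : M.Prec len (s.1, rank P x) (t.1, f (rank P x)) :=
    ⟨h1, h2, h5, of.lt h5, f, hf, rfl⟩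
  have h6 := rank_le ((hS.maps.isEmb _ _ hp).mapsTo hxr)
  rw [← hext, hr, ← hfe] at h6
  exact absurd ((of.lt_iff_lt h5 h3).2 hlt) h6.not_gt

lemma pull_lt {q x : X} {α : Ordinal.{u}} (h : Pull M len P σ q α x) : α < len := by
  obtain ⟨ν, h, -⟩ := h
  exact h.1

lemma pull_mem (hS : IsFSPresystem M len P σ e) {q x : X} {α : Ordinal.{u}}
    (h : Pull M len P σ q α x) : x ∈ (P (M.ht α)).carrier := by
  obtain ⟨ν, h, hx, -⟩ := h
  exact hS.mem_mono (Order.add_one_le_of_lt h.2.2.1) (hS.premorass.ht_mono h.1.le le_rfl) hx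

lemma pull_unique (hS : IsFSPresystem M len P σ e) {q x y : X} {α : Ordinal.{u}}
    (hx : Pull M len P σ q α x) (hy : Pull M len P σ q α y) : x = y := by
  obtain ⟨ν, h1, h2, h3⟩ := hx
  obtain ⟨ν', h4, h5, h6⟩ := hy
  obtain rfl := hS.premorass.prec_unique h1 h4
  exact hS.maps.injOn _ _ h1 h2 h5 (h3.trans h6.symm)

lemma exists_pull (hS : IsFSPresystem M len P σ e) {q : X}
    (hq : q ∈ (P (M.ht len)).carrier) : ∃ α x, Pull M len P σ q α x := by
  obtain ⟨h1, h2⟩ := hS.rank_spec (hS.premorass.ht_pos len le_rfl) le_rfl hq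
  have := hS.maps.limit (len, rank P q) le_rfl h2 hS.premorass.isSuccLimit_len
  rw [this] at h1
  obtain ⟨⟨α, ν⟩, hs, x, hx, hxq⟩ := h1
  exact ⟨α, x, ν, hs, hx, hxq⟩

lemma exists_pull_of_le (hS : IsFSPresystem M len P σ e) {q x : X} {α β : Ordinal.{u}}
    (hx : Pull M len P σ q α x) (h : α ≤ β) (hβ : β < len) : ∃ y, Pull M len P σ q β y := by
  rcases h.eq_or_lt with rfl | h
  · exact ⟨x, hx⟩
  obtain ⟨ν, h1, h2, h3⟩ := hx
  obtain ⟨τ, h4, h5⟩ := hS.premorass.prec_between h1 h hβ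
  exact ⟨_, τ, h5, (hS.maps.isEmb _ _ h4).mapsTo h2, by rw [← hS.maps.comm _ _ _ h4 h5 x h2, h3]⟩

lemma minLevel_le {q x : X} {α : Ordinal.{u}} (h : Pull M len P σ q α x) :
    minLevel M len P σ q ≤ α :=
  csInf_le' ⟨x, h⟩

lemma pull_minLevel (hS : IsFSPresystem M len P σ e) {q : X}
    (hq : q ∈ (P (M.ht len)).carrier) : ∃ x, Pull M len P σ q (minLevel M len P σ q) x :=
  csInf_mem (s := {α | ∃ x, Pull M len P σ q α x}) (hS.exists_pull hq)

lemma exists_pull_iff (hS : IsFSPresystem M len P σ e) {q : X} {α : Ordinal.{u}}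
    (hq : q ∈ (P (M.ht len)).carrier) :
    (∃ x, Pull M len P σ q α x) ↔ minLevel M len P σ q ≤ α ∧ α < len := by
  constructor
  · rintro ⟨x, hx⟩
    exact ⟨minLevel_le hx, pull_lt hx⟩
  · rintro ⟨h1, h2⟩
    obtain ⟨x, hx⟩ := hS.pull_minLevel hq
    exact hS.exists_pull_of_le hx h1 h2

lemma minLevel_lt (hS : IsFSPresystem M len P σ e) {q : X}
    (hq : q ∈ (P (M.ht len)).carrier) : minLevel M len P σ q < len := by
  obtain ⟨x, hx⟩ := hS.pull_minLevel hq
  exact pull_lt hx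

lemma pull_rank (hS : IsFSPresystem M len P σ e) {q x : X} {α : Ordinal.{u}}
    (hx : Pull M len P σ q α x) : M.Prec len (α, rank P x) (len, rank P q) ∧
      x ∈ (P (rank P x + 1)).carrier ∧ σ (α, rank P x) (len, rank P q) x = q := by
  obtain ⟨ν, h1, h2, h3⟩ := hx
  have := hS.rank_of_rank_apply h1 h2 (by rw [h3])
  subst this
  exact ⟨h1, h2, h3⟩

/-- The least level is not a limit: on a limit level, every condition comes from below. -/
lemma not_isSuccLimit_minLevel (hS : IsFSPresystem M len P σ e) {q : X}
    (hq : q ∈ (P (M.ht len)).carrier) : ¬ Order.IsSuccLimit (minLevel M len P σ q) := by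
  intro hl
  obtain ⟨x, hx⟩ := hS.pull_minLevel hq
  obtain ⟨ν, h1, h2, h3⟩ := hx
  have h4 := h2
  rw [hS.maps.limit (_, ν) h1.1.le h1.2.2.1 hl] at h4
  obtain ⟨⟨β, ζ⟩, h5, y, hy, hyx⟩ := h4
  have h6 : Pull M len P σ q β y :=
    ⟨ζ, hS.premorass.prec_trans h5 h1, hy, by rw [hS.maps.comm _ _ _ h5 h1 y hy, hyx, h3]⟩
  exact absurd h5.1 (minLevel_le h6).not_gt

/-- Two pullbacks of `q` are connected by the corresponding map between their levels. -/
lemma pull_compare (hS : IsFSPresystem M len P σ e) {q x y : X} {α β : Ordinal.{u}}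
    (hx : Pull M len P σ q β x) (hy : Pull M len P σ q α y ∨ α = len ∧ y = q) (h : β < α) :
    M.Prec len (β, rank P x) (α, rank P y) ∧ σ (β, rank P x) (α, rank P y) x = y := by
  obtain ⟨h1, h2, h3⟩ := hS.pull_rank hx
  rcases hy with hy | ⟨rfl, rfl⟩
  · obtain ⟨h4, h5, h6⟩ := hS.pull_rank hy
    obtain ⟨τ, h7, h8⟩ := hS.premorass.prec_between h1 h (pull_lt hy)
    obtain rfl := hS.premorass.prec_unique h4 h8
    refine ⟨h7, hS.maps.injOn _ _ h8 ((hS.maps.isEmb _ _ h7).mapsTo h2) h5 ?_⟩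
    rw [← hS.maps.comm _ _ _ h7 h8 x h2, h3, h6]
  · exact ⟨h1, h3⟩

/-- A condition of `P (ht α)` is its own pullback to the level `α`. -/
lemma pull_self (hS : IsFSPresystem M len P σ e) {y : X} {α : Ordinal.{u}} (hα : α < len)
    (hy : y ∈ (P (M.ht α)).carrier) : Pull M len P σ y α y := by
  have hle := hS.premorass.ht_mono hα.le le_rfl
  obtain ⟨h1, h2⟩ := hS.rank_spec (hS.premorass.ht_pos α hα.le) hle hy
  obtain ⟨f, hf, hfe⟩ := hS.premorass.exists_id hα le_rfl h2
  have hp : M.Prec len (α, rank P y) (len, rank P y) :=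
    ⟨hα, le_rfl, h2, h2.trans_le hle, f, hf, hfe _ le_rfl⟩
  exact ⟨_, hp, h1, hS.maps.map_id _ _ hp f hf (hfe _ le_rfl) hfe y h1⟩

lemma e_mem (hS : IsFSPresystem M len P σ e) {α : Ordinal.{u}} (hα : α < len) {y : X}
    (hy : y ∈ (P (M.ht (α + 1))).carrier) : e α y ∈ (P (M.ht α)).carrier :=
  hS.maps.e_mapsTo α hα hy

lemma iterate_mem (hS : IsFSPresystem M len P σ e) {p : X} (hp : p ∈ (P (M.ht len)).carrier)
    {n : ℕ} {q : X} (h : IsIterate M len P σ e p n q) : q ∈ (P (M.ht len)).carrier := by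
  cases n with
  | zero => exact h ▸ hp
  | succ n =>
    obtain ⟨r, β, x, -, -, hx, rfl⟩ := h
    have hβ : β < len := (lt_add_one β).trans (pull_lt hx)
    exact hS.mem_mono (hS.premorass.ht_mono hβ.le le_rfl) le_rfl (hS.e_mem hβ (hS.pull_mem hx))

lemma iterate_unique (hS : IsFSPresystem M len P σ e) {p : X} {n : ℕ} {q q' : X}
    (h : IsIterate M len P σ e p n q) (h' : IsIterate M len P σ e p n q') : q = q' := by
  induction n generalizing q q' with
  | zero => exact h.trans h'.symm
  | succ n ih =>
    obtain ⟨r, β, x, h1, h2, h3, rfl⟩ := h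
    obtain ⟨r', β', x', h1', h2', h3', rfl⟩ := h'
    obtain rfl := ih h1 h1'
    obtain rfl : β = β' := Order.add_one_inj.1 (h2.symm.trans h2')
    rw [hS.pull_unique h3 h3']

lemma minLevel_iterate_succ_lt (hS : IsFSPresystem M len P σ e) {p : X} {n : ℕ} {q r : X}
    (h : IsIterate M len P σ e p n q) (h' : IsIterate M len P σ e p (n + 1) r) :
    minLevel M len P σ r < minLevel M len P σ q := by
  obtain ⟨q', β, x, h1, h2, h3, rfl⟩ := h'
  obtain rfl := hS.iterate_unique h h1
  have hβ : β < len := (lt_add_one β).trans (pull_lt h3)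
  rw [h2]
  exact Order.lt_add_one_iff.2 (minLevel_le (hS.pull_self hβ (hS.e_mem hβ (hS.pull_mem h3))))

lemma minLevel_iterate_lt (hS : IsFSPresystem M len P σ e) {p : X} {m n : ℕ} {q r : X}
    (hmn : m < n) (h : IsIterate M len P σ e p m q) (h' : IsIterate M len P σ e p n r) :
    minLevel M len P σ r < minLevel M len P σ q := by
  induction n generalizing r with
  | zero => exact absurd hmn (Nat.not_lt_zero m)
  | succ n ih =>
    obtain ⟨s, β, x, h1, h2⟩ := id h'
    have h3 := hS.minLevel_iterate_succ_lt h1 h'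
    rcases (Nat.lt_succ_iff.1 hmn).eq_or_lt with rfl | h4
    · rwa [hS.iterate_unique h h1]
    · exact h3.trans (ih h4 h1)

variable (M len P σ e) in
/-- `q = p_n`, where `n` is the index with `γ_n(p) ≤ α < γ_{n-1}(p)`. -/
def IsStage (p : X) (α : Ordinal.{u}) (n : ℕ) (q : X) : Prop :=
  IsIterate M len P σ e p n q ∧ minLevel M len P σ q ≤ α ∧
    ∀ m r, n = m + 1 → IsIterate M len P σ e p m r → α < minLevel M len P σ r

variable (M len P σ e) in
/-- `x = p*(α)`, where the function `p*` is extended by the value `p` at `len`. -/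
def IsTrace (p : X) (α : Ordinal.{u}) (x : X) : Prop :=
  ∃ n q, IsStage M len P σ e p α n q ∧ (Pull M len P σ q α x ∨ α = len ∧ x = q)

lemma exists_stage (hS : IsFSPresystem M len P σ e) {p : X} (hp : p ∈ (P (M.ht len)).carrier)
    (α : Ordinal.{u}) : ∃ n q, IsStage M len P σ e p α n q := by
  classical
  have key : ∃ n q, IsIterate M len P σ e p n q ∧ minLevel M len P σ q ≤ α := by
    -- The least value of `minLevel` on the iterates is `0`.
    obtain ⟨γ, ⟨n, q, hn, rfl⟩, hmin⟩ := WellFounded.has_min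
      (wellFounded_lt : WellFounded ((· < ·) : Ordinal.{u} → Ordinal.{u} → Prop))
      {γ | ∃ n q, IsIterate M len P σ e p n q ∧ γ = minLevel M len P σ q} ⟨_, 0, p, rfl, rfl⟩
    refine ⟨n, q, hn, ?_⟩
    have hq := hS.iterate_mem hp hn
    rcases zero_or_add_one_or_isSuccLimit (minLevel M len P σ q) with h | ⟨β, h⟩ | h
    · simp [h]
    · obtain ⟨x, hx⟩ := hS.pull_minLevel hq
      have h' : IsIterate M len P σ e p (n + 1) (e β x) := ⟨q, β, x, hn, h, h ▸ hx, rfl⟩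
      exact absurd (hS.minLevel_iterate_succ_lt hn h') (hmin _ ⟨_, _, h', rfl⟩)
    · exact absurd h (hS.not_isSuccLimit_minLevel hq)
  obtain ⟨q, h1, h2⟩ := Nat.find_spec key
  refine ⟨Nat.find key, q, h1, h2, fun m r hm hr => ?_⟩
  by_contra! hc
  exact Nat.find_min key (hm ▸ Nat.lt_succ_self m) ⟨r, hr, hc⟩

lemma exists_iterate_of_le {p : X} {m n : ℕ} {q : X} (hmn : m ≤ n)
    (h : IsIterate M len P σ e p n q) : ∃ r, IsIterate M len P σ e p m r := by
  induction n generalizing q with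
  | zero => exact ⟨q, by rwa [Nat.le_zero.1 hmn]⟩
  | succ n ih =>
    rcases hmn.eq_or_lt with rfl | h'
    · exact ⟨q, h⟩
    · obtain ⟨r, -, -, h1, -⟩ := h
      exact ih (Nat.lt_succ_iff.1 h') h1

lemma stage_le (hS : IsFSPresystem M len P σ e) {p : X} {α : Ordinal.{u}} {m n : ℕ} {q r : X}
    (h : IsStage M len P σ e p α n q) (h' : IsIterate M len P σ e p m r)
    (hr : minLevel M len P σ r ≤ α) : n ≤ m := by
  by_contra! hc
  obtain ⟨k, rfl⟩ : ∃ k, n = k + 1 := ⟨n - 1, by omega⟩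
  obtain ⟨s, hs⟩ := exists_iterate_of_le (Nat.le_succ k) h.1
  have h2 := h.2.2 k s rfl hs
  rcases (Nat.lt_succ_iff.1 hc).eq_or_lt with rfl | h3
  · rw [hS.iterate_unique hs h'] at h2
    exact hr.not_gt h2
  · exact absurd (h2.trans (hS.minLevel_iterate_lt h3 h' hs)) hr.not_gt

lemma stage_unique (hS : IsFSPresystem M len P σ e) {p : X} {α : Ordinal.{u}} {m n : ℕ} {q r : X}
    (h : IsStage M len P σ e p α n q) (h' : IsStage M len P σ e p α m r) : q = r := by
  obtain rfl := (hS.stage_le h h'.1 h'.2.1).antisymm (hS.stage_le h' h.1 h.2.1)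
  exact hS.iterate_unique h.1 h'.1

lemma exists_trace (hS : IsFSPresystem M len P σ e) {p : X} (hp : p ∈ (P (M.ht len)).carrier)
    {α : Ordinal.{u}} (hα : α ≤ len) : ∃ x, IsTrace M len P σ e p α x := by
  obtain ⟨n, q, h⟩ := hS.exists_stage hp α
  rcases hα.eq_or_lt with rfl | hα
  · exact ⟨q, n, q, h, Or.inr ⟨rfl, rfl⟩⟩
  · obtain ⟨x, hx⟩ := (hS.exists_pull_iff (hS.iterate_mem hp h.1)).2 ⟨h.2.1, hα⟩
    exact ⟨x, n, q, h, Or.inl hx⟩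

lemma trace_unique (hS : IsFSPresystem M len P σ e) {p : X} {α : Ordinal.{u}} {x y : X}
    (hx : IsTrace M len P σ e p α x) (hy : IsTrace M len P σ e p α y) : x = y := by
  obtain ⟨n, q, h1, h2⟩ := hx
  obtain ⟨m, r, h3, h4⟩ := hy
  obtain rfl := hS.stage_unique h1 h3
  rcases h2 with h2 | ⟨h2, rfl⟩ <;> rcases h4 with h4 | ⟨h4, rfl⟩
  · exact hS.pull_unique h2 h4
  · exact absurd (pull_lt h2) h4.not_lt
  · exact absurd (pull_lt h4) h2.not_lt
  · rfl

lemma trace_mem (hS : IsFSPresystem M len P σ e) {p : X} (hp : p ∈ (P (M.ht len)).carrier)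
    {α : Ordinal.{u}} {x : X} (hx : IsTrace M len P σ e p α x) : x ∈ (P (M.ht α)).carrier := by
  obtain ⟨n, q, h1, h2 | ⟨rfl, rfl⟩⟩ := hx
  · exact hS.pull_mem h2
  · exact hS.iterate_mem hp h1.1

lemma trace_len (hS : IsFSPresystem M len P σ e) {p : X} (hp : p ∈ (P (M.ht len)).carrier) :
    IsTrace M len P σ e p len p :=
  ⟨0, p, ⟨rfl, (hS.minLevel_lt hp).le, fun _ _ h => absurd h (Nat.succ_ne_zero _).symm⟩,
    Or.inr ⟨rfl, rfl⟩⟩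

/-- The trace at `α + 1` and the trace at `α` are related by `e_α`, and, if `α + 1` is not in the
support, also by the identity or by `σ_α`. -/
lemma trace_add_one (hS : IsFSPresystem M len P σ e) {p : X} (hp : p ∈ (P (M.ht len)).carrier)
    {α : Ordinal.{u}} (hα : α < len) {x y : X} (hx : IsTrace M len P σ e p α x)
    (hy : IsTrace M len P σ e p (α + 1) y) :
    e α y = x ∧ (α + 1 ∉ supp M len P σ e p → y = x ∨
      ∃ h ∈ M.maps α (α + 1), h ≠ idOn (M.ht α) ∧ y = unionMap P σ α (α + 1) h x) := by
  have hα1 : α + 1 < len := hS.premorass.isSuccLimit_len.add_one_lt hα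
  obtain ⟨n, q, h1, h2⟩ := hy
  have h2' : Pull M len P σ q (α + 1) y := h2.resolve_right fun h => hα1.ne h.1
  rcases h1.2.1.eq_or_lt with h3 | h3
  · have hit : IsIterate M len P σ e p (n + 1) (e α y) := ⟨q, α, y, h1.1, h3, h2', rfl⟩
    have hpl := hS.pull_self hα (hS.e_mem hα (hS.pull_mem h2'))
    refine ⟨hS.trace_unique ⟨n + 1, _, ⟨hit, minLevel_le hpl, ?_⟩, Or.inl hpl⟩ hx, fun hn =>
      absurd ⟨n, q, h1.1, h3.symm⟩ hn⟩
    intro m r hm hr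
    obtain rfl : n = m := by omega
    rw [hS.iterate_unique hr h1.1, h3]
    exact lt_add_one α
  · have h3 := Order.lt_add_one_iff.1 h3
    obtain ⟨z, hz⟩ := (hS.exists_pull_iff (hS.iterate_mem hp h1.1)).2 ⟨h3, hα⟩
    obtain rfl : z = x := hS.trace_unique ⟨n, q, ⟨h1.1, h3, fun m r hm hr =>
      (lt_add_one α).trans (h1.2.2 m r hm hr)⟩, Or.inl hz⟩ hx
    obtain ⟨h4, h5⟩ := hS.pull_compare hz (Or.inl h2') (lt_add_one α)
    have hzm := (hS.pull_rank hz).2.1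
    have hzα := hS.pull_mem hz
    obtain ⟨-, -, h6, -, f, hf, hfe⟩ := id h4
    simp only at hf hfe h6
    by_cases hid : f = idOn (M.ht α)
    · have : y = z := by
        rw [← h5]
        refine hS.maps.map_id _ _ h4 f hf hfe (fun ξ hξ => ?_) z hzm
        rw [hid, idOn_apply (hξ.trans_lt h6)]
      exact ⟨by rw [this]; exact hS.maps.e_of_mem α hα z hzα, fun _ => Or.inl this⟩
    · have : y = unionMap P σ α (α + 1) f z := by
        rw [unionMap, hfe, h5]
      exact ⟨by rw [this]; exact hS.maps.e_of_range α hα f hf hid z hzα,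
        fun _ => Or.inr ⟨f, hf, hid, this⟩⟩

/-- On a limit level, the trace comes from the traces on all sufficiently large smaller levels. -/
lemma trace_limit (hS : IsFSPresystem M len P σ e) {p : X} (hp : p ∈ (P (M.ht len)).carrier)
    {α : Ordinal.{u}} (hα : α ≤ len) (hl : Order.IsSuccLimit α) {y : X}
    (hy : IsTrace M len P σ e p α y) :
    ∃ β₀ < α, ∀ β, β₀ ≤ β → β < α → ∀ x, IsTrace M len P σ e p β x →
      M.Prec len (β, rank P x) (α, rank P y) ∧ x ∈ (P (rank P x + 1)).carrier ∧
        σ (β, rank P x) (α, rank P y) x = y := by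
  obtain ⟨n, q, h1, h2⟩ := hy
  have hq := hS.iterate_mem hp h1.1
  refine ⟨_, h1.2.1.lt_of_ne fun h => hS.not_isSuccLimit_minLevel hq (h ▸ hl), ?_⟩
  intro β hβ hβα x hx
  obtain ⟨z, hz⟩ := (hS.exists_pull_iff hq).2 ⟨hβ, hβα.trans_le hα⟩
  obtain rfl : z = x := hS.trace_unique ⟨n, q, ⟨h1.1, hβ, fun m r hm hr =>
    hβα.trans (h1.2.2 m r hm hr)⟩, Or.inl hz⟩ hx
  obtain ⟨h3, h4⟩ := hS.pull_compare hz h2 hβα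
  exact ⟨h3, (hS.pull_rank hz).2.1, h4⟩

/-- Compatibility of traces climbs up the levels outside the common support: at a successor level
missing from one of the supports, that trace is an image of the previous one while the other
trace is reduced by the previous one. -/
lemma compat_trace (hS : IsFSPresystem M len P σ e) {p q : X} (hp : p ∈ (P (M.ht len)).carrier)
    (hq : q ∈ (P (M.ht len)).carrier) {γ : Ordinal.{u}}
    (hγ : ∀ x y, IsTrace M len P σ e p γ x → IsTrace M len P σ e q γ y →
      (P (M.ht γ)).Compat x y)
    (α : Ordinal.{u}) : α ≤ len → γ ≤ α →
    (∀ β, γ < β → β ≤ α → β ∈ supp M len P σ e p → β ∈ supp M len P σ e q → ∀ x y,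
      IsTrace M len P σ e p β x → IsTrace M len P σ e q β y → (P (M.ht β)).Compat x y) →
    ∀ x y, IsTrace M len P σ e p α x → IsTrace M len P σ e q α y → (P (M.ht α)).Compat x y := by
  induction α using WellFoundedLT.induction with
  | ind α ih =>
    intro hα hγα hsupp x y hx hy
    rcases hγα.eq_or_lt with rfl | hγα
    · exact hγ x y hx hy
    rcases zero_or_add_one_or_isSuccLimit α with h | ⟨β, rfl⟩ | hl
    · exact absurd hγα (by simp [h])
    · have hβ := lt_add_one β
      have hβl : β < len := hβ.trans_le hα
      obtain ⟨x', hx'⟩ := hS.exists_trace hp hβl.le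
      obtain ⟨y', hy'⟩ := hS.exists_trace hq hβl.le
      have hc := ih β hβ hβl.le (Order.lt_add_one_iff.1 hγα)
        (fun ζ h1 h2 => hsupp ζ h1 (h2.trans hβ.le)) x' y' hx' hy'
      -- Half of the successor step; the other half is symmetric.
      have step : ∀ p q x y x' y', p ∈ (P (M.ht len)).carrier → q ∈ (P (M.ht len)).carrier →
          IsTrace M len P σ e p (β + 1) x → IsTrace M len P σ e q (β + 1) y →
          IsTrace M len P σ e p β x' → IsTrace M len P σ e q β y' →
          β + 1 ∉ supp M len P σ e p → (P (M.ht β)).Compat x' y' →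
          (P (M.ht (β + 1))).Compat x y := by
        intro p q x y x' y' hp hq hx hy hx' hy' hn hc
        have hord := hS.chain.isForcingOrder _ (hS.premorass.ht_mono hα le_rfl)
        have hxm := hS.trace_mem hp hx'
        have hym := hS.trace_mem hq hy
        have hye := (hS.trace_add_one hq hβl hy' hy).1
        rcases (hS.trace_add_one hp hβl hx' hx).2 hn with rfl | ⟨h, hh, hid, rfl⟩
        · obtain ⟨h1, h2⟩ := hS.maps.id_complete β hβl
          exact (h2 y hym).compat (f := id) hord h1.toIsEmb hxm (hye ▸ hc)
        · obtain ⟨h1, h2⟩ := hS.maps.h_complete β hβl h hh hid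
          exact (h2 y hym).compat hord h1.toIsEmb hxm (hye ▸ hc)
      by_cases hsp : β + 1 ∈ supp M len P σ e p
      · by_cases hsq : β + 1 ∈ supp M len P σ e q
        · exact hsupp _ hγα le_rfl hsp hsq x y hx hy
        · exact (step q p y x y' x' hq hp hy hx hy' hx' hsq hc.symm).symm
      · exact step p q x y x' y' hp hq hx hy hx' hy' hsp hc
    · obtain ⟨β₁, hβ₁, H₁⟩ := hS.trace_limit hp hα hl hx
      obtain ⟨β₂, hβ₂, H₂⟩ := hS.trace_limit hq hα hl hy
      have hβ : max (max β₁ β₂) γ < α := max_lt (max_lt hβ₁ hβ₂) hγα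
      obtain ⟨x', hx'⟩ := hS.exists_trace hp (hβ.le.trans hα)
      obtain ⟨y', hy'⟩ := hS.exists_trace hq (hβ.le.trans hα)
      obtain ⟨⟨-, -, a1, -, f₁, hf₁, hfe₁⟩, -⟩ :=
        H₁ _ ((le_max_left _ _).trans (le_max_left _ _)) hβ x' hx'
      obtain ⟨⟨-, -, b1, -, f₂, hf₂, hfe₂⟩, -⟩ :=
        H₂ _ ((le_max_right _ _).trans (le_max_left _ _)) hβ y' hy'
      obtain ⟨ζ, h1, -, h3, g, hg, j₁, hj₁, j₂, hj₂, e1, e2⟩ :=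
        hS.premorass.exists_common hα hl hβ hβ hf₁ hf₂
      simp only at hfe₁ hfe₂ a1 b1
      have hζ := h3.le.trans hα
      have hγζ : γ ≤ ζ := (le_max_right _ _).trans h1.le
      obtain ⟨x₂, hx₂⟩ := hS.exists_trace hp hζ
      obtain ⟨y₂, hy₂⟩ := hS.exists_trace hq hζ
      obtain ⟨c1, c2, c3⟩ :=
        H₁ ζ (((le_max_left _ _).trans (le_max_left _ _)).trans h1.le) h3 x₂ hx₂
      obtain ⟨d1, d2, d3⟩ :=
        H₂ ζ (((le_max_right _ _).trans (le_max_left _ _)).trans h1.le) h3 y₂ hy₂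
      have hc := ih ζ h3 hζ hγζ (fun β h1 h2 => hsupp β h1 (h2.trans h3.le)) x₂ y₂ hx₂ hy₂
      have oj₁ := hS.premorass.isOrderMap _ _ h1 hζ _ hj₁
      have oj₂ := hS.premorass.isOrderMap _ _ h1 hζ _ hj₂
      have og := hS.premorass.isOrderMap _ _ h3 hα _ hg
      -- One map `g` sends the ranks of both traces at `ζ` to the ranks of the traces at `α`.
      have gx : g (rank P x₂) = rank P x := by
        have : M.Prec len (ζ, j₁ (rank P x')) (α, rank P x) :=
          ⟨h3, hα, oj₁.lt a1, c1.2.2.2.1, g, hg, by rw [← hfe₁, e1 _ a1]⟩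
        rw [hS.premorass.prec_unique c1 this, ← e1 _ a1, hfe₁]
      have gy : g (rank P y₂) = rank P y := by
        have : M.Prec len (ζ, j₂ (rank P y')) (α, rank P y) :=
          ⟨h3, hα, oj₂.lt b1, d1.2.2.2.1, g, hg, by rw [← hfe₂, e2 _ b1]⟩
        rw [hS.premorass.prec_unique d1 this, ← e2 _ b1, hfe₂]
      set ν := max (rank P x₂) (rank P y₂) with hν
      have hνζ : ν < M.ht ζ := max_lt c1.2.2.1 d1.2.2.1
      have hν1 : ν + 1 ≤ M.ht len := hS.add_one_le_ht hνζ hζ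
      have hpr : M.Prec len (ζ, ν) (α, g ν) := ⟨h3, hα, hνζ, og.lt hνζ, g, hg, rfl⟩
      have hxν : x₂ ∈ (P (ν + 1)).carrier :=
        hS.mem_mono (add_le_add_left (le_max_left _ _) 1) hν1 c2
      have hyν : y₂ ∈ (P (ν + 1)).carrier :=
        hS.mem_mono (add_le_add_left (le_max_right _ _) 1) hν1 d2
      have hex := hS.maps.extend _ _ hpr g hg rfl _ (le_max_left _ _) x₂ c2
      have hey := hS.maps.extend _ _ hpr g hg rfl _ (le_max_right _ _) y₂ d2
      simp only at hex hey
      rw [gx, c3] at hex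
      rw [gy, d3] at hey
      have emb := hS.maps.isEmb _ _ hpr
      rw [← hS.compat_iff (Order.add_one_le_of_lt hνζ) (hS.premorass.ht_mono hζ le_rfl) hxν hyν]
        at hc
      have hc' := (emb.compat_iff hxν hyν).1 hc
      have hx' := emb.mapsTo hxν
      have hy' := emb.mapsTo hyν
      rw [hex] at hc' hx'
      rw [hey] at hc' hy'
      exact (hS.compat_iff (Order.add_one_le_of_lt (og.lt hνζ))
        (hS.premorass.ht_mono hα le_rfl) hx' hy').1 hc'

end IsFSPresystem
end System

/-! ### The derived order -/

namespace IsFSPresystem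

variable {X : Type v} {M : Gap1Data.{u}} {len : Ordinal.{u}} {P : Ordinal.{u} → Forcing X}
  {σ : Ordinal.{u} × Ordinal.{u} → Ordinal.{u} × Ordinal.{u} → X → X} {e : Ordinal.{u} → X → X}

/-- The function `p* ↾ supp(p)` consists of the pairs `⟨γ_n(p), p^(n)(γ_n(p))⟩`. -/
lemma mem_starSupp_iff (hS : IsFSPresystem M len P σ e) {p x : X} {α : Ordinal.{u}} :
    (α, x) ∈ starSupp M len P σ e p ↔ ∃ n q, IsIterate M len P σ e p n q ∧
      α = minLevel M len P σ q ∧ Pull M len P σ q α x := by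
  constructor
  · rintro ⟨⟨n, q, h1, h2, h3, -, h5⟩, ⟨m, r, h6, h7⟩⟩
    simp only at h2 h3 h5 h7
    refine ⟨n, q, h1, ?_, h2⟩
    have hnm := hS.stage_le ⟨h1, h3, h5⟩ h6 h7.ge
    rcases hnm.eq_or_lt with rfl | hlt
    · rwa [hS.iterate_unique h1 h6]
    · exact absurd h3 (by rw [h7]; exact (hS.minLevel_iterate_lt hlt h1 h6).not_ge)
  · rintro ⟨n, q, h1, h2, h3⟩
    refine ⟨⟨n, q, h1, h3, h2.ge, pull_lt h3, fun m r hm hr => ?_⟩, n, q, h1, h2⟩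
    subst hm
    rw [h2]
    exact hS.minLevel_iterate_succ_lt hr h1

lemma trace_of_mem_starSupp {p x : X} {α : Ordinal.{u}}
    (h : (α, x) ∈ starSupp M len P σ e p) : IsTrace M len P σ e p α x := by
  obtain ⟨⟨n, q, h1, h2, h3, -, h5⟩, -⟩ := h
  exact ⟨n, q, ⟨h1, h3, h5⟩, Or.inl h2⟩

lemma lt_of_mem_starSupp {p x : X} {α : Ordinal.{u}}
    (h : (α, x) ∈ starSupp M len P σ e p) : α < len :=
  h.1.choose_spec.choose_spec.2.2.2.1

lemma dom_starSupp (hS : IsFSPresystem M len P σ e) {p : X} (hp : p ∈ (P (M.ht len)).carrier) :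
    dom (starSupp M len P σ e p) = supp M len P σ e p := by
  ext α
  constructor
  · rintro ⟨a, ha, rfl⟩
    exact ha.2
  · rintro ⟨n, q, h1, h2⟩
    obtain ⟨x, hx⟩ := hS.pull_minLevel (hS.iterate_mem hp h1)
    rw [← h2] at hx
    exact ⟨(α, x), hS.mem_starSupp_iff.2 ⟨n, q, h1, h2, hx⟩, rfl⟩

lemma supp_subset (hS : IsFSPresystem M len P σ e) {p : X} (hp : p ∈ (P (M.ht len)).carrier) :
    supp M len P σ e p ⊆ Iio len := by
  rintro α ⟨n, q, h1, rfl⟩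
  exact hS.minLevel_lt (hS.iterate_mem hp h1)

lemma exists_iterate_minLevel_eq_zero (hS : IsFSPresystem M len P σ e) {p : X}
    (hp : p ∈ (P (M.ht len)).carrier) :
    ∃ n q, IsIterate M len P σ e p n q ∧ minLevel M len P σ q = 0 := by
  obtain ⟨n, q, h1, h2, -⟩ := hS.exists_stage hp 0
  exact ⟨n, q, h1, nonpos_iff_eq_zero.1 h2⟩

lemma zero_mem_supp (hS : IsFSPresystem M len P σ e) {p : X}
    (hp : p ∈ (P (M.ht len)).carrier) : 0 ∈ supp M len P σ e p := by
  obtain ⟨n, q, h1, h2⟩ := hS.exists_iterate_minLevel_eq_zero hp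
  exact ⟨n, q, h1, h2.symm⟩

lemma finite_supp (hS : IsFSPresystem M len P σ e) {p : X}
    (hp : p ∈ (P (M.ht len)).carrier) : (supp M len P σ e p).Finite := by
  obtain ⟨n, q, h1, h2⟩ := hS.exists_iterate_minLevel_eq_zero hp
  refine Set.Finite.subset (s := ⋃ k ∈ Finset.range (n + 1),
    {γ | ∃ q, IsIterate M len P σ e p k q ∧ γ = minLevel M len P σ q}) ?_ ?_
  · refine Set.Finite.biUnion (Finset.finite_toSet _) fun k _ => Set.Subsingleton.finite ?_
    rintro _ ⟨q, hq, rfl⟩ _ ⟨r, hr, rfl⟩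
    rw [hS.iterate_unique hq hr]
  · rintro γ ⟨m, r, h3, h4⟩
    simp only [mem_iUnion]
    refine ⟨m, ?_, r, h3, h4⟩
    rw [Finset.mem_range]
    by_contra! hc
    have := hS.minLevel_iterate_lt (Nat.lt_of_succ_le hc) h1 h3
    rw [h2] at this
    exact not_lt_zero this

lemma iterate_add (hS : IsFSPresystem M len P σ e) {p q r : X} {n k : ℕ}
    (hq : IsIterate M len P σ e p n q) :
    IsIterate M len P σ e p (n + k) r ↔ IsIterate M len P σ e q k r := by
  induction k generalizing r with
  | zero => exact ⟨fun h => hS.iterate_unique h hq, fun h => by rw [show r = q from h]; exact hq⟩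
  | succ k ih =>
    constructor
    · rintro ⟨s, β, x, h1, h2⟩
      exact ⟨s, β, x, ih.1 h1, h2⟩
    · rintro ⟨s, β, x, h1, h2⟩
      exact ⟨s, β, x, ih.2 h1, h2⟩

/-- The restriction of an element of the derived order to `η > 0` is again an element of the derived
order, namely the one given by the first `p_n` with `γ_n(p) < η`. -/
lemma exists_starSupp_eq_restrict (hS : IsFSPresystem M len P σ e) {p : X}
    (hp : p ∈ (P (M.ht len)).carrier) {η : Ordinal.{u}} (hη : 0 < η) :
    ∃ q ∈ (P (M.ht len)).carrier,
      starSupp M len P σ e q = {a | a ∈ starSupp M len P σ e p ∧ a.1 < η} := by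
  classical
  have key : ∃ n q, IsIterate M len P σ e p n q ∧ minLevel M len P σ q < η := by
    obtain ⟨n, q, h1, h2⟩ := hS.exists_iterate_minLevel_eq_zero hp
    exact ⟨n, q, h1, h2 ▸ hη⟩
  obtain ⟨q, h1, h2⟩ := Nat.find_spec key
  have hmin := fun m => Nat.find_min key (m := m)
  generalize Nat.find key = n at h1 hmin
  refine ⟨q, hS.iterate_mem hp h1, ?_⟩
  ext ⟨α, x⟩
  simp only [mem_ofPred_eq, hS.mem_starSupp_iff]
  constructor
  · rintro ⟨k, r, h3, h4, h5⟩
    have h6 := (hS.iterate_add h1).2 h3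
    refine ⟨⟨_, r, h6, h4, h5⟩, ?_⟩
    rw [h4]
    rcases Nat.eq_zero_or_pos k with rfl | hk
    · rwa [hS.iterate_unique h6 h1]
    · exact (hS.minLevel_iterate_lt (by omega) h1 h6).trans h2
  · rintro ⟨⟨m, r, h3, h4, h5⟩, h6⟩
    have hm : n ≤ m := by
      by_contra! hc
      exact hmin m hc ⟨r, h3, h4 ▸ h6⟩
    obtain ⟨k, rfl⟩ := Nat.exists_eq_add_of_le hm
    exact ⟨k, r, (hS.iterate_add h1).1 h3, h4, h5⟩

lemma isForcingOrder_derivedBelow (hS : IsFSPresystem M len P σ e) (η : Ordinal.{u}) :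
    (derivedBelow M len P σ e η).IsForcingOrder := by
  constructor
  · rintro _ ⟨⟨p, hp, rfl⟩, -⟩
    refine ⟨Subset.rfl, fun α x y hx hy => ?_⟩
    have hx := trace_of_mem_starSupp hx
    rw [← hS.trace_unique hx (trace_of_mem_starSupp hy)]
    have hα := lt_of_mem_starSupp hy
    exact (hS.chain.isForcingOrder _ (hS.premorass.ht_mono hα.le le_rfl)).1 _ (hS.trace_mem hp hx)
  · rintro _ ⟨⟨p, hp, rfl⟩, -⟩ _ ⟨⟨q, hq, rfl⟩, -⟩ _ ⟨⟨r, hr, rfl⟩, -⟩ ⟨h1, h2⟩ ⟨h3, h4⟩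
    refine ⟨h3.trans h1, fun α x z hx hz => ?_⟩
    obtain ⟨⟨β, y⟩, hy, rfl⟩ := h3 ⟨(α, z), hz, rfl⟩
    have hα := lt_of_mem_starSupp hx
    exact (hS.chain.isForcingOrder _ (hS.premorass.ht_mono hα.le le_rfl)).2
      _ (hS.trace_mem hp (trace_of_mem_starSupp hx)) _ (hS.trace_mem hq (trace_of_mem_starSupp hy))
      _ (hS.trace_mem hr (trace_of_mem_starSupp hz)) (h2 _ _ _ hx hy) (h4 _ _ _ hy hz)

lemma derivedBelow_len (hS : IsFSPresystem M len P σ e) :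
    derivedBelow M len P σ e len = derived M len P σ e := by
  have : (derivedBelow M len P σ e len).carrier = (derived M len P σ e).carrier := by
    refine Subset.antisymm (fun a h => h.1) ?_
    rintro _ ⟨p, hp, rfl⟩
    exact ⟨⟨p, hp, rfl⟩, by rw [hS.dom_starSupp hp]; exact hS.supp_subset hp⟩
  calc derivedBelow M len P σ e len
      = ⟨(derivedBelow M len P σ e len).carrier, (derived M len P σ e).le⟩ := rfl
    _ = derived M len P σ e := by rw [this]

/-- The orders `Q_η` form a forcing chain: a common extension of elements of `Q_η` may be
restricted to `η`, and supports are finite. -/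
lemma isForcingChain_derivedBelow (hS : IsFSPresystem M len P σ e) :
    IsForcingChain len (derivedBelow M len P σ e) where
  isForcingOrder η _ := hS.isForcingOrder_derivedBelow η
  incl η ν h _ :=
    { mapsTo := fun a ha => ⟨ha.1, ha.2.trans (Iio_subset_Iio h)⟩
      mono := fun _ _ _ _ h => h
      incompat_iff := by
        rintro a ha b hb
        rw [not_iff_not]
        constructor
        · rintro ⟨c, hc, h1, h2⟩
          exact ⟨c, ⟨hc.1, hc.2.trans (Iio_subset_Iio h)⟩, h1, h2⟩
        · rintro ⟨_, ⟨⟨r, hr, rfl⟩, -⟩, h1, h2⟩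
          have hη : 0 < η := by
            obtain ⟨⟨p, hp, rfl⟩, hpη⟩ := ha
            rw [hS.dom_starSupp hp] at hpη
            exact hpη (hS.zero_mem_supp hp)
          obtain ⟨q, hq, hqe⟩ := hS.exists_starSupp_eq_restrict hr hη
          have hle : ∀ a ∈ (derivedBelow M len P σ e η).carrier,
              (derivedBelow M len P σ e ν).le (starSupp M len P σ e r) (id a) →
              (derivedBelow M len P σ e η).le (starSupp M len P σ e q) a := by
            rintro a ⟨-, ha⟩ ⟨h1, h2⟩
            refine ⟨fun α hα => ?_, fun α x y hx hy => ?_⟩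
            · obtain ⟨b, hb, rfl⟩ := h1 hα
              exact ⟨b, by rw [hqe]; exact ⟨hb, ha hα⟩, rfl⟩
            · rw [hqe] at hx
              exact h2 α x y hx.1 hy
          refine ⟨_, ⟨⟨q, hq, rfl⟩, ?_⟩, hle a ha h1, hle b hb h2⟩
          rintro _ ⟨b, hb, rfl⟩
          rw [hqe] at hb
          exact hb.2 }
  union l _ hl := by
    ext a
    simp only [mem_iUnion]
    constructor
    · rintro ⟨⟨p, hp, rfl⟩, hd⟩
      rw [hS.dom_starSupp hp] at hd
      obtain ⟨m, hm, hmax⟩ :=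
        Set.exists_max_image _ id (hS.finite_supp hp) ⟨0, hS.zero_mem_supp hp⟩
      refine ⟨m + 1, hl.add_one_lt (hd hm), ⟨p, hp, rfl⟩, ?_⟩
      rw [hS.dom_starSupp hp]
      exact fun α hα => Order.lt_add_one_iff.2 (hmax α hα)
    · rintro ⟨η, hη, h1, h2⟩
      exact ⟨h1, h2.trans (Iio_subset_Iio hη.le)⟩

/-- The map `p ↦ p* ↾ supp(p)` reflects compatibility. -/
lemma compat_of_compat_starSupp (hS : IsFSPresystem M len P σ e) {p q : X}
    (hp : p ∈ (P (M.ht len)).carrier) (hq : q ∈ (P (M.ht len)).carrier)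
    (h : (derived M len P σ e).Compat (starSupp M len P σ e p) (starSupp M len P σ e q)) :
    (P (M.ht len)).Compat p q := by
  obtain ⟨_, ⟨r, hr, rfl⟩, ⟨h1, h2⟩, ⟨h3, h4⟩⟩ := h
  have key : ∀ β, β ∈ supp M len P σ e p → β ∈ supp M len P σ e q → ∀ x y,
      IsTrace M len P σ e p β x → IsTrace M len P σ e q β y → (P (M.ht β)).Compat x y := by
    intro β hβp hβq x y hx hy
    rw [← hS.dom_starSupp hp] at hβp
    rw [← hS.dom_starSupp hq] at hβq
    obtain ⟨⟨γ, z⟩, hz, he⟩ := h1 hβp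
    obtain ⟨⟨β', x'⟩, hx', rfl⟩ := hβp
    obtain ⟨⟨β'', y'⟩, hy', he'⟩ := hβq
    simp only at he he' hx hy
    subst he he'
    rw [hS.trace_unique hx (trace_of_mem_starSupp hx'),
      hS.trace_unique hy (trace_of_mem_starSupp hy')]
    exact ⟨z, hS.trace_mem hr (trace_of_mem_starSupp hz), h2 _ _ _ hz hx', h4 _ _ _ hz hy'⟩
  exact hS.compat_trace hp hq (γ := 0) (key 0 (hS.zero_mem_supp hp) (hS.zero_mem_supp hq)) len le_rfl
    (by simp) (fun β _ _ => key β) p q (hS.trace_len hp) (hS.trace_len hq)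

lemma chainCondition_of_derived (hS : IsFSPresystem M len P σ e) {μ : Cardinal.{w}}
    (h : (derived M len P σ e).ChainCondition μ) : (P (M.ht len)).ChainCondition μ := by
  refine Forcing.ChainCondition.of_reflects (hS.chain.isForcingOrder _ le_rfl) ?_ h
    (starSupp M len P σ e) (fun p hp => ⟨p, hp, rfl⟩) (fun p hp q hq => hS.compat_of_compat_starSupp hp hq)
  rw [← hS.derivedBelow_len]
  exact hS.isForcingOrder_derivedBelow len

end IsFSPresystem

/-! ### Families of finite sets of ordinals -/

lemma exists_lt_subset_Iic {a : Ordinal.{u}} (ha : 0 < a) {s : Set Ordinal.{u}} (hfin : s.Finite)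
    (hs : s ⊆ Iio a) : ∃ γ < a, s ⊆ Iic γ := by
  by_cases hne : s.Nonempty
  · obtain ⟨m, hm, hmax⟩ := Set.exists_max_image _ id hfin hne
    exact ⟨m, hs hm, hmax⟩
  · exact ⟨0, ha, by simp [not_nonempty_iff_eq_empty.1 hne]⟩

/-- If `κ` is regular and `cf(μ) ≠ κ`, then a map from a set of size `μ` to `κ` is bounded on a
subset of size `μ`. -/
lemma exists_bounded_of_cof_ne {κ μ : Cardinal.{u}} (hκ : κ.IsRegular) (hμ : ℵ₀ ≤ μ)
    (hcof : μ.ord.cof ≠ κ) {I : Type u} (hI : #I = μ) (b : I → Ordinal.{u})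
    (hb : ∀ i, b i < κ.ord) : ∃ α < κ.ord, μ ≤ #{i | b i ≤ α} := by
  let f : I → κ.ord.ToType := fun i => Ordinal.ToType.mk ⟨b i, hb i⟩
  have hcκ := hκ.cof_ord
  rcases lt_or_gt_of_ne hcof with h | h
  · rcases lt_trichotomy μ κ with h1 | h1 | h1
    · refine ⟨⨆ i, b i, Ordinal.iSup_lt_of_lt_cof (by rwa [hcκ, hI]) hb, ?_⟩
      rw [← hI, ← Cardinal.mk_univ]
      exact Cardinal.mk_le_mk_of_subset fun i _ => Ordinal.le_iSup b i
    · exact absurd (h1 ▸ hcκ) (h1 ▸ hcof)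
    · -- The sizes `g k < μ` of the sets `{i | f i ≤ k}` increase with `k < κ`. If they were
      -- unbounded in `μ`, then, as `cf(μ) < κ`, one of them would already bound a cofinal subset of
      -- `μ`, which is absurd. So they are bounded by some `ν < μ`, and then `#I ≤ κ * ν < μ`.
      by_contra! hc
      let g : κ.ord.ToType → Cardinal.{u} := fun k => #{i | f i ≤ k}
      have hg : ∀ k, g k < μ := by
        intro k
        refine (Cardinal.mk_le_mk_of_subset fun i (hi : f i ≤ k) => ?_).trans_lt
          (hc _ (mem_Iio.1 (Ordinal.ToType.mk.symm k).2))
        rw [← OrderIso.le_symm_apply, ← Subtype.coe_le_coe] at hi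
        exact hi
      have hmono : Monotone g := fun k l hkl =>
        Cardinal.mk_le_mk_of_subset fun i (hi : f i ≤ k) => hi.trans hkl
      have hsup : ∃ ν < μ, ∀ k, g k ≤ ν := by
        by_contra! hn
        obtain ⟨S, hS, hScard⟩ := Order.exists_cof_eq μ.ord.ToType
        rw [← Ordinal.cof_type, Ordinal.type_toType] at hScard
        have h2 : ∀ x : S, ∃ k, (Ordinal.ToType.mk.symm x.1 : Ordinal).card < g k := fun x =>
          hn _ (Cardinal.lt_ord.1 (Ordinal.ToType.mk.symm x.1).2)
        choose k hk using h2
        let α := ⨆ x : S, (Ordinal.ToType.mk.symm (k x) : Ordinal)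
        have hα : α < κ.ord := Ordinal.iSup_lt_of_lt_cof (by rwa [hcκ, hScard])
          fun x => (Ordinal.ToType.mk.symm (k x)).2
        let l := Ordinal.ToType.mk ⟨α, hα⟩
        have hkl : ∀ x, k x ≤ l := fun x => by
          rw [← OrderIso.symm_apply_le]
          exact Ordinal.le_iSup (fun x : S => (Ordinal.ToType.mk.symm (k x) : Ordinal)) x
        obtain ⟨x, hxS, hx⟩ := hS (Ordinal.ToType.mk ⟨(g l).ord, Cardinal.ord_lt_ord.2 (hg l)⟩)
        rw [← OrderIso.le_symm_apply, ← Subtype.coe_le_coe] at hx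
        have h3 : g l ≤ (Ordinal.ToType.mk.symm x : Ordinal).card := Cardinal.ord_le.1 hx
        exact absurd ((hk ⟨x, hxS⟩).trans_le (hmono (hkl _))) h3.not_gt
      obtain ⟨ν, hν, hle⟩ := hsup
      have hcover : #I ≤ κ * ν := by
        have : (univ : Set I) = ⋃ k, {i | f i ≤ k} :=
          Set.ext fun i =>
            ⟨fun _ => mem_iUnion.2 ⟨f i, mem_ofPred_eq ▸ le_refl (f i)⟩, fun _ => trivial⟩
        rw [← Cardinal.mk_univ, this]
        refine (Cardinal.mk_iUnion_le _).trans ?_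
        rw [Cardinal.mk_ord_toType]
        exact mul_le_mul_right (ciSup_le' hle) κ
      rw [hI] at hcover
      exact absurd (Cardinal.mul_lt_of_lt hμ h1 hν) hcover.not_gt
  · obtain ⟨k, hk⟩ := Cardinal.infinite_pigeonhole_card f μ hI.ge hμ
      (by rwa [Cardinal.mk_ord_toType])
    refine ⟨_, mem_Iio.1 (Ordinal.ToType.mk.symm k).2,
      hk.trans (Cardinal.mk_le_mk_of_subset fun i hi => ?_)⟩
    rw [mem_preimage, mem_singleton_iff] at hi
    simp [← hi, f]

/-- A weak form of the `Δ`-system lemma: among `κ` finite subsets of a regular uncountable `κ`, there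
are `κ` many that are pairwise disjoint above some `α < κ`. -/
lemma exists_pairwise_disjoint_above {κ : Cardinal.{u}} (hκ : κ.IsRegular) (hκω : ℵ₀ < κ)
    {I : Type u} (hI : #I = κ) (s : I → Set Ordinal.{u}) (hfin : ∀ i, (s i).Finite)
    (hs : ∀ i, s i ⊆ Iio κ.ord) :
    ∃ α < κ.ord, ∃ J : Set I, κ ≤ #J ∧
      J.Pairwise fun i j => ∀ β, α < β → β ∈ s i → β ∉ s j := by
  classical
  have hcκ := hκ.cof_ord
  -- Some `α` and the least `n` with `κ` many sets having at most `n` elements above `α`.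
  have key : ∃ n : ℕ, ∃ α < κ.ord, κ ≤ #{i | (s i ∩ Ioi α).ncard ≤ n} := by
    obtain ⟨n, hn⟩ := Cardinal.infinite_pigeonhole_card
      (fun i => ULift.up.{u} (s i ∩ Ioi 0).ncard) κ hI.ge hκω.le (by simpa [hcκ] using hκω)
    refine ⟨n.down, 0, hκ.ord_pos, hn.trans (Cardinal.mk_le_mk_of_subset fun i hi => ?_)⟩
    rw [mem_preimage, mem_singleton_iff] at hi
    simp [← hi]
  obtain ⟨α, hα, hB⟩ := Nat.find_spec key
  have hmin := fun m => Nat.find_min key (m := m)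
  generalize Nat.find key = n at hB hmin
  set B := {i | (s i ∩ Ioi α).ncard ≤ n} with hBdef
  have hD : ∀ β, α ≤ β → β < κ.ord → #{i | i ∈ B ∧ (s i ∩ Ioc α β).Nonempty} < κ := by
    intro β hαβ hβ
    by_contra! hc
    have hlt : ∀ i, i ∈ B → (s i ∩ Ioc α β).Nonempty → (s i ∩ Ioi β).ncard < n := by
      rintro i hi ⟨ζ, hζ, hζ'⟩
      refine lt_of_lt_of_le (Set.ncard_lt_ncard ?_ ((hfin i).inter_of_left _)) hi
      refine (ssubset_iff_of_subset ?_).2 ⟨ζ, ⟨hζ, hζ'.1⟩, fun h => hζ'.2.not_gt h.2⟩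
      exact inter_subset_inter_right _ (Ioi_subset_Ioi hαβ)
    have hne : Nonempty {i | i ∈ B ∧ (s i ∩ Ioc α β).Nonempty} :=
      Cardinal.mk_ne_zero_iff.1 (hκ.pos.trans_le hc).ne'
    obtain ⟨i, hi, hi'⟩ := hne
    have hn : n - 1 < n := by have := hlt i hi hi'; omega
    refine hmin (n - 1) hn ⟨β, hβ, hc.trans (Cardinal.mk_le_mk_of_subset ?_)⟩
    rintro j ⟨hj, hj'⟩
    have := hlt j hj hj'
    rw [mem_ofPred_eq]
    omega
  let R : I → I → Prop := fun i j => ∀ β, α < β → β ∈ s i → β ∉ s j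
  obtain ⟨J, hJ⟩ := zorn_subset {J | J ⊆ B ∧ J.Pairwise R} (by
    intro c hc hchain
    refine ⟨⋃₀ c, ⟨sUnion_subset fun t ht => (hc ht).1, ?_⟩, fun t ht => subset_sUnion_of_mem ht⟩
    exact (Set.pairwise_sUnion hchain.directedOn).2 fun t ht => (hc ht).2)
  refine ⟨α, hα, J, ?_, hJ.prop.2⟩
  -- A family of fewer than `κ` sets is bounded by some `β < κ`, hence is not maximal.
  by_contra! hlt
  have hb : ∀ i, ∃ γ < κ.ord, s i ⊆ Iic γ := fun i =>
    exists_lt_subset_Iic hκ.ord_pos (hfin i) (hs i)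
  choose b hb hsb using hb
  set β := max α (⨆ i : J, b i) with hβdef
  have hβ : β < κ.ord := max_lt hα (Ordinal.iSup_lt_of_lt_cof (by rwa [hcκ]) fun i => hb i)
  have hsmall : #↑({i | i ∈ B ∧ (s i ∩ Ioc α β).Nonempty} ∪ J : Set I) < #B :=
    ((Cardinal.mk_union_le _ _).trans_lt
      (Cardinal.add_lt_of_lt hκω.le (hD β (le_max_left _ _) hβ) hlt)).trans_le hB
  have hnot : ¬ B ⊆ {i | i ∈ B ∧ (s i ∩ Ioc α β).Nonempty} ∪ J := fun h =>
    (Cardinal.mk_le_mk_of_subset h).not_gt hsmall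
  obtain ⟨i, hiB, hi⟩ := not_subset.1 hnot
  have hiD : ∀ ζ ∈ s i, α < ζ → β < ζ := by
    intro ζ hζ hαζ
    by_contra! hc
    exact hi (Or.inl ⟨hiB, ζ, hζ, hαζ, hc⟩)
  refine hi (Or.inr (hJ.le_of_ge (y := insert i J) ⟨insert_subset hiB hJ.prop.1, ?_⟩
    (subset_insert i J) (mem_insert i J)))
  have hJb : ∀ j ∈ J, ∀ ζ ∈ s j, ζ ≤ β := fun j hj ζ hζ =>
    (hsb j hζ).trans ((Ordinal.le_iSup (fun i : J => b i) ⟨j, hj⟩).trans (le_max_right _ _))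
  refine hJ.prop.2.insert fun j hj _ => ⟨?_, ?_⟩
  · exact fun ζ hαζ hζ hζ' => (hJb j hj ζ hζ').not_gt (hiD ζ hζ hαζ)
  · exact fun ζ hαζ hζ hζ' => (hJb j hj ζ hζ).not_gt (hiD ζ hζ' hαζ)

lemma exists_pairwise_disjoint_above_of_isRegular_or_cof_ne {κ μ : Cardinal.{u}}
    (hκ : κ.IsRegular) (hκω : ℵ₀ < κ) (hμω : ℵ₀ < μ) (hμ : μ.IsRegular ∨ μ.ord.cof ≠ κ)
    {I : Type u} (hI : #I = μ) (s : I → Set Ordinal.{u}) (hfin : ∀ i, (s i).Finite)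
    (hs : ∀ i, s i ⊆ Iio κ.ord) :
    ∃ α < κ.ord, ∃ J : Set I, #J = μ ∧
      J.Pairwise fun i j => ∀ β, α < β → β ∈ s i → β ∉ s j := by
  suffices h : ∃ α < κ.ord, ∃ J : Set I, μ ≤ #J ∧
      J.Pairwise fun i j => ∀ β, α < β → β ∈ s i → β ∉ s j by
    obtain ⟨α, hα, J, hJ, hJ'⟩ := h
    exact ⟨α, hα, J, ((Cardinal.mk_set_le J).trans hI.le).antisymm hJ, hJ'⟩
  by_cases hcof : μ.ord.cof = κ
  · have hμκ : μ = κ := (hμ.resolve_right fun h => h hcof).cof_ord.symm.trans hcof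
    subst hμκ
    exact exists_pairwise_disjoint_above hκ hκω hI s hfin hs
  · have hb : ∀ i, ∃ γ < κ.ord, s i ⊆ Iic γ := fun i =>
      exists_lt_subset_Iic hκ.ord_pos (hfin i) (hs i)
    choose b hb hsb using hb
    obtain ⟨α, hα, h⟩ := exists_bounded_of_cof_ne hκ hμω.le hcof hI b hb
    exact ⟨α, hα, _, h, fun i hi _ _ _ β hβ hβi _ =>
      hβ.not_ge ((hsb i hβi).trans hi)⟩

/-- The chain condition lifts from the proper levels to the top of an FS system whose length is a
regular uncountable cardinal `κ`. -/
lemma IsFSPresystem.chainCondition_top {X : Type v} {M : Gap1Data.{u}} {κ μ : Cardinal.{u}}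
    {P : Ordinal.{u} → Forcing X}
    {σ : Ordinal.{u} × Ordinal.{u} → Ordinal.{u} × Ordinal.{u} → X → X} {e : Ordinal.{u} → X → X}
    (hS : IsFSPresystem M κ.ord P σ e) (hκ : κ.IsRegular) (hκω : ℵ₀ < κ) (hμω : ℵ₀ < μ)
    (hμ : μ.IsRegular ∨ μ.ord.cof ≠ κ)
    (hcc : ∀ α < κ.ord, (P (M.ht α)).ChainCondition μ) :
    (P (M.ht κ.ord)).ChainCondition μ := by
  refine (hS.chain.isForcingOrder _ le_rfl).chainCondition_iff.2 fun I a hI ha => ?_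
  obtain ⟨α, hα, J, hJ, hdisj⟩ := exists_pairwise_disjoint_above_of_isRegular_or_cof_ne hκ hκω hμω
    hμ hI (fun i => supp M κ.ord P σ e (a i)) (fun i => hS.finite_supp (ha i))
    (fun i => hS.supp_subset (ha i))
  choose t ht using fun i => hS.exists_trace (ha i) hα.le
  have hord := hS.chain.isForcingOrder _ (hS.premorass.ht_mono hα.le le_rfl)
  obtain ⟨i, j, hij, hc⟩ := hord.chainCondition_iff.1 (hcc α hα) J (fun i => t i) hJ
    fun i => hS.trace_mem (ha i) (ht i)
  have hne : (i : I) ≠ j := fun h => hij (Subtype.ext h)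
  refine ⟨i, j, hne, hS.compat_trace (ha i) (ha j) (γ := α) ?_ κ.ord le_rfl hα.le ?_ _ _
    (hS.trace_len (ha i)) (hS.trace_len (ha j))⟩
  · intro x y hx hy
    rwa [hS.trace_unique hx (ht i), hS.trace_unique hy (ht j)]
  · exact fun β hβ _ h1 h2 => absurd h2 (hdisj i.2 j.2 hne β hβ h1)

/-! ### The two premorasses of a gap-2 morass -/

lemma Gap1Data.IsSimplifiedMorass.isPremorass {M : Gap1Data.{u}} {κ : Cardinal.{u}}
    (hM : M.IsSimplifiedMorass κ) (hκ : ℵ₀ ≤ κ) : M.IsPremorass κ.ord where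
  isSuccLimit_len := Cardinal.isSuccLimit_ord hκ
  ht_pos α hα := by
    rcases hα.eq_or_lt with rfl | hα
    · rw [hM.ht_top]
      exact Cardinal.ord_pos.2 (Order.bot_lt_succ κ)
    · exact hM.ht_pos α hα
  isOrderMap := hM.isOrderMap
  comp := hM.comp
  succ := hM.succ
  limit := hM.limit
  union α hα hl τ hτ := by
    have : τ ∈ Iio (M.ht α) := hτ
    rwa [hM.union α hα hl.bot_lt] at this

open Classical in
/-- The left-branching embedding from level `θ` to level `θ'` given by `g ∈ maps θ θ'`. -/
noncomputable def leftEmb (M : Gap1Data.{u}) (θ θ' : Ordinal.{u}) (g : Ordinal.{u} → Ordinal.{u}) :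
    EmbData.{u} where
  ord ζ := if ζ < θ then ζ else if ζ = θ then θ' else 0
  pt ζ τ := if ζ < θ then idOn (M.ht ζ) τ else if ζ = θ then g τ else 0
  mor ζ ξ b := if ζ < ξ ∧ ξ ≤ θ ∧ b ∈ M.maps ζ ξ then
    if ξ < θ then b else compOn (M.ht ζ) g b else fun _ => 0

lemma Gap1Data.IsPremorass.splitPoint_lt {M : Gap1Data.{u}} {len ζ : Ordinal.{u}}
    (hM : M.IsPremorass len) (hζ : ζ < len) : M.splitPoint ζ < M.ht ζ := by
  obtain ⟨h, δ, hδ, -, hge, hm⟩ := hM.succ ζ hζ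
  have hne : {δ | δ < M.ht ζ ∧ ∃ b ∈ M.maps ζ (ζ + 1), b δ ≠ δ}.Nonempty :=
    ⟨δ, hδ, h, by simp [hm], (hδ.trans_le hge).ne'⟩
  exact (csInf_mem hne).1

lemma isLeftBranching_leftEmb {M : Gap1Data.{u}} {len θ θ' : Ordinal.{u}}
    (hM : M.IsPremorass len) (hθ : θ < θ') (hθ' : θ' ≤ len) {g : Ordinal.{u} → Ordinal.{u}}
    (hg : g ∈ M.maps θ θ') : IsLeftBranching M θ θ' (leftEmb M θ θ' g) := by
  have ord_lt : ∀ ζ < θ, (leftEmb M θ θ' g).ord ζ = ζ := fun ζ h => if_pos h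
  have ord_self : (leftEmb M θ θ' g).ord θ = θ' := by simp [leftEmb]
  have pt_lt : ∀ ζ < θ, (leftEmb M θ θ' g).pt ζ = idOn (M.ht ζ) := fun ζ h => by
    ext τ; simp [leftEmb, h]
  have pt_self : (leftEmb M θ θ' g).pt θ = g := by ext τ; simp [leftEmb]
  have mor_lt : ∀ ζ ξ, ζ < ξ → ξ < θ → ∀ b ∈ M.maps ζ ξ, (leftEmb M θ θ' g).mor ζ ξ b = b :=
    fun ζ ξ h1 h2 b hb => by simp [leftEmb, h1, h2, h2.le, hb]
  have mor_self : ∀ ζ < θ, ∀ b ∈ M.maps ζ θ,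
      (leftEmb M θ θ' g).mor ζ θ b = compOn (M.ht ζ) g b := fun ζ h b hb => by
    simp [leftEmb, h, hb]
  have og := hM.isOrderMap _ _ hθ hθ' g hg
  refine ⟨⟨?_, ord_self, ?_, ?_, ?_, ?_, ?_, ?_, ?_, ?_⟩, ord_lt, ?_, mor_lt,
    pt_self.symm ▸ hg, ?_⟩
  · intro ζ hζ ξ hξ h
    have hζ' : ζ < θ := h.trans_le hξ
    rw [ord_lt ζ hζ']
    rcases (mem_Iic.1 hξ).eq_or_lt with rfl | hξ
    · rw [ord_self]; exact hζ'.trans hθ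
    · rwa [ord_lt ξ hξ]
  · intro ζ hζ
    simp [leftEmb, hζ.not_gt, hζ.ne']
  · intro ζ hζ
    rcases hζ.eq_or_lt with rfl | hζ
    · rwa [ord_self, pt_self]
    · rw [ord_lt ζ hζ, pt_lt ζ hζ]
      refine ⟨fun ξ hξ τ hτ h => ?_, fun ξ hξ => ?_, fun ξ hξ => restr_of_le hξ _⟩
      · rwa [idOn_apply hξ, idOn_apply hτ]
      · rwa [idOn_apply hξ]
  · intro ζ hζ τ
    simp [leftEmb, hζ.not_gt, hζ.ne']
  · intro ζ ξ h1 h2 b hb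
    rw [ord_lt ζ (h1.trans_le h2)]
    rcases h2.eq_or_lt with rfl | h2
    · rw [ord_self, mor_self ζ h1 b hb]
      exact hM.comp_mem h1 hθ hθ' hg hb
    · rwa [ord_lt ξ h2, mor_lt ζ ξ h1 h2 b hb]
  · intro ζ ξ b h
    simp [leftEmb, h]
  · intro ζ hζ
    rw [ord_lt ζ hζ, pt_lt ζ hζ, idOn_apply (hM.splitPoint_lt (hζ.trans (hθ.trans_le hθ')))]
  · intro ζ ξ η h1 h2 h3 b hb c hc
    have h4 := h2.trans_le h3
    have hηl : η ≤ len := h3.trans (hθ.le.trans hθ')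
    have hbc := hM.comp_mem h1 h2 hηl hc hb
    rw [ord_lt ζ (h1.trans h4), mor_lt ζ ξ h1 h4 b hb]
    rcases h3.eq_or_lt with rfl | h3
    · rw [mor_self ζ (h1.trans h2) _ hbc, mor_self ξ h2 c hc]
      ext τ
      by_cases hτ : τ < M.ht ζ
      · rw [compOn_apply hτ, compOn_apply hτ, compOn_apply hτ, compOn_apply
          ((hM.isOrderMap _ _ h1 (h2.le.trans hηl) b hb).lt hτ)]
      · simp only [compOn, restr_of_le (not_lt.1 hτ)]
    · rw [mor_lt ζ η (h1.trans h2) h3 _ hbc, mor_lt ξ η h2 h3 c hc]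
  · intro ζ ξ h1 h2 b hb τ hτ
    have h3 : ξ ≤ len := h2.trans (hθ.le.trans hθ')
    have hbτ := (hM.isOrderMap _ _ h1 h3 b hb).lt hτ
    rw [pt_lt ζ (h1.trans_le h2), idOn_apply hτ]
    rcases h2.eq_or_lt with rfl | h2
    · rw [pt_self, mor_self ζ h1 b hb, compOn_apply hτ]
    · rw [pt_lt ξ h2, mor_lt ζ ξ h1 h2 b hb, idOn_apply hbτ]
  · intro ζ hζ τ hτ
    rw [pt_lt ζ hζ, idOn_apply hτ]
  · intro ζ hζ b hb
    rw [mor_self ζ hζ b hb, pt_self]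

lemma restr_ord_embComp {M : Gap1Data.{u}} {θ θ' : Ordinal.{u}} {f g : EmbData.{u}}
    (hg : IsEmbedding M θ θ' g) :
    restr θ (embComp M θ f g).ord = compOn θ (restr θ' f.ord) (restr θ g.ord) := by
  ext ξ
  by_cases hξ : ξ < θ
  · have h1 : g.ord ξ < θ' := by
      rw [← hg.ord_top]
      exact hg.ord_strictMono (mem_Iic.2 hξ.le) (mem_Iic.2 le_rfl) hξ
    rw [restr_apply hξ, compOn_apply hξ, restr_apply hξ, restr_apply h1]
    simp [embComp, hξ.le]
  · simp only [compOn, restr_of_le (not_lt.1 hξ)]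

/-- The induced morass is a premorass. Its maps from `α` to `α + 1` are the identity, which comes
from the left-branching embeddings, and the map given by the right-branching embedding. -/
lemma Gap2Data.IsSimplifiedMorass.isPremorass_induced {M : Gap2Data.{u}} {κ : Cardinal.{u}}
    (hM : M.IsSimplifiedMorass κ) : M.induced.IsPremorass κ.ord where
  isSuccLimit_len := Cardinal.isSuccLimit_ord hM.regular.aleph0_le
  ht_pos α hα := by
    change 0 < M.len α
    rcases hα.eq_or_lt with rfl | hα
    · rw [hM.len_top]
      exact Cardinal.ord_pos.2 (Order.bot_lt_succ κ)
    · exact hM.len_pos α hα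
  isOrderMap := by
    rintro α β h1 h2 _ ⟨f, hf, rfl⟩
    have hf := hM.isEmbedding α β h1 h2 f hf
    change IsOrderMap (M.len α) (M.len β) _
    refine ⟨fun ξ hξ τ hτ h => ?_, fun ξ hξ => ?_, fun ξ hξ => restr_of_le hξ _⟩
    · simp only [restr_apply hξ, restr_apply hτ]
      exact hf.ord_strictMono (mem_Iic.2 (mem_Iio.1 hξ).le) (mem_Iic.2 (mem_Iio.1 hτ).le) h
    · simp only [restr_apply hξ]
      rw [mem_Iio, ← hf.ord_top]
      exact hf.ord_strictMono (mem_Iic.2 (mem_Iio.1 hξ).le) (mem_Iic.2 le_rfl) hξ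
  comp := by
    intro α β γ h1 h2 h3
    have key : ∀ f g, g ∈ M.embs α β → restr (M.len α) (embComp M.gap1 (M.len α) f g).ord =
        compOn (M.len α) (restr (M.len β) f.ord) (restr (M.len α) g.ord) := fun f g hg =>
      restr_ord_embComp (hM.isEmbedding α β h1 (h2.le.trans h3) g hg)
    ext k
    constructor
    · rintro ⟨k, hk, rfl⟩
      rw [hM.comp α β γ h1 h2 h3] at hk
      obtain ⟨f, hf, g, hg, rfl⟩ := hk
      exact ⟨_, ⟨f, hf, rfl⟩, _, ⟨g, hg, rfl⟩, key f g hg⟩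
    · rintro ⟨_, ⟨f, hf, rfl⟩, _, ⟨g, hg, rfl⟩, rfl⟩
      refine ⟨embComp M.gap1 (M.len α) f g, ?_, key f g hg⟩
      rw [hM.comp α β γ h1 h2 h3]
      exact ⟨f, hf, g, hg, rfl⟩
  succ α hα := by
    obtain ⟨hlt, h, hr, he⟩ := hM.succ α hα
    obtain ⟨-, η, hη, hid, hadd, -⟩ := hr
    have hgap1 := hM.gap1.isPremorass (hM.regular.aleph0_le.trans (Order.le_succ κ))
    have hle : M.len (α + 1) ≤ (Order.succ κ).ord :=
      (hM.len_lt _ ((Cardinal.isSuccLimit_ord hM.regular.aleph0_le).add_one_lt hα)).le.trans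
        (Cardinal.ord_le_ord.2 (Order.le_succ κ))
    have hleft : ∀ f, IsLeftBranching M.gap1 (M.len α) (M.len (α + 1)) f →
        restr (M.len α) f.ord = idOn (M.len α) := by
      intro f hf
      ext ξ
      by_cases hξ : ξ < M.len α
      · rw [restr_apply hξ, idOn_apply hξ, hf.ord_eq ξ hξ]
      · rw [idOn, restr_of_le (not_lt.1 hξ), restr_of_le (not_lt.1 hξ)]
    refine ⟨restr (M.len α) h.ord, η, hη, fun ξ hξ => ?_, ?_, ?_⟩
    · rw [restr_apply (hξ.trans hη), hid ξ hξ]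
    · have := hadd 0 (by simpa using hη.le)
      simp only [add_zero] at this
      rw [restr_apply hη, this]
      exact le_rfl
    · change (fun f : EmbData.{u} => restr (M.len α) f.ord) '' M.embs α (α + 1) =
        {idOn (M.len α), restr (M.len α) h.ord}
      rw [he]
      ext k
      constructor
      · rintro ⟨f, hf | rfl, rfl⟩
        · exact Or.inl (hleft f hf)
        · exact Or.inr rfl
      · rintro (rfl | rfl)
        · obtain ⟨g, hg⟩ := hgap1.nonempty_maps _ hle _ hlt
          have hb := isLeftBranching_leftEmb hgap1 hlt hle hg
          exact ⟨_, Or.inl hb, hleft _ hb⟩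
        · exact ⟨h, Or.inr rfl, rfl⟩
  limit := by
    rintro α hα hl β₁ h1 β₂ h2 _ ⟨f₁, hf₁, rfl⟩ _ ⟨f₂, hf₂, rfl⟩
    obtain ⟨γ, h3, h4, h5, g, hg, j₁, hj₁, j₂, hj₂, rfl, rfl⟩ :=
      hM.limit α hα hl β₁ h1 β₂ h2 f₁ hf₁ f₂ hf₂
    have hγ := h5.le.trans hα
    exact ⟨γ, h3, h4, h5, _, ⟨g, hg, rfl⟩, _, ⟨j₁, hj₁, rfl⟩, _, ⟨j₂, hj₂, rfl⟩,
      restr_ord_embComp (hM.isEmbedding _ _ h3 hγ _ hj₁),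
      restr_ord_embComp (hM.isEmbedding _ _ h4 hγ _ hj₂)⟩
  union α hα hl τ hτ := by
    have : τ ∈ Iio (M.len α) := hτ
    rw [hM.union_len α hα hl] at this
    obtain ⟨β, hβ, f, hf, ζ, hζ, rfl⟩ := this
    exact ⟨β, hβ, _, ⟨f, hf, rfl⟩, ζ, hζ, restr_apply hζ _⟩

end Morass

theorem theorem3p3 {X : Type u} (κ μ : Cardinal.{u}) (hκ : κ.IsRegular) (hκω : ℵ₀ < κ)
    (hμω : ℵ₀ < μ) (M : Morass.Gap2Data.{u}) (hM : M.IsSimplifiedMorass κ)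
    (P : Ordinal.{u} → Morass.Forcing X)
    (σ : Ordinal.{u} × Ordinal.{u} → Ordinal.{u} × Ordinal.{u} → X → X)
    (σ' : Ordinal.{u} × Ordinal.{u} → Ordinal.{u} × Ordinal.{u} →
      Set (Ordinal.{u} × X) → Set (Ordinal.{u} × X))
    (e : Ordinal.{u} → X → X)
    (e' : Ordinal.{u} → Set (Ordinal.{u} × X) → Set (Ordinal.{u} × X))
    (hS : Morass.IsFSSystem₂ M κ P σ σ' e e') :
    ((Morass.derived M.gap1 (Order.succ κ).ord P σ e).ChainCondition μ →
      (P (Order.succ (Order.succ κ)).ord).ChainCondition μ) ∧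
    ((μ.IsRegular ∨ μ.ord.cof ≠ κ) →
      (∀ η < κ.ord,
        (Morass.derivedBelow M.gap1 (Order.succ κ).ord P σ e η).ChainCondition μ) →
      (P (Order.succ (Order.succ κ)).ord).ChainCondition μ) := by
  have hP : Morass.IsFSPresystem M.gap1 (Order.succ κ).ord P σ e :=
    ⟨hM.gap1.isPremorass (hκ.aleph0_le.trans (Order.le_succ κ)),
      by rw [hM.gap1.ht_top]; exact hS.gap1.chain, hS.gap1.maps⟩
  have htop : M.induced.ht κ.ord = (Order.succ κ).ord := hM.len_top
  have hQ : Morass.IsFSPresystem M.induced κ.ord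
      (Morass.derivedBelow M.gap1 (Order.succ κ).ord P σ e) σ' e' :=
    ⟨hM.isPremorass_induced, by rw [htop]; exact hP.isForcingChain_derivedBelow, hS.maps'⟩
  have ha : (Morass.derived M.gap1 (Order.succ κ).ord P σ e).ChainCondition μ →
      (P (Order.succ (Order.succ κ)).ord).ChainCondition μ := by
    intro h
    rw [← hM.gap1.ht_top]
    exact hP.chainCondition_of_derived h
  refine ⟨ha, fun hμ hcc => ha ?_⟩
  have := hQ.chainCondition_top hκ hκω hμω hμ fun α hα => hcc _ (hM.len_lt α hα)
  rwa [htop, hP.derivedBelow_len] at this
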